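/- Let $(R,\mathfrak m,k)$ be a Gorenstein (commutative Noetherian) local ring of Krull dimension $d>0$. For a finitely generated $R$-module $M$, let $\Omega^n M$ denote the $n$-th syzygy of $M$ in its minimal free resolution (with $\Omega^0M=M$). We say that $M$ has rank $r$, and write $\operatorname{rank} M=r$, if $M\otimes_R Q$ is a free $Q$-module of rank $r$, where $Q$ is the total ring of fractions of $R$. (1) If $R$ is not regular, then there is an $R$-module $M$ of finite length and infinite projective dimension such that $\Omega^{d-1}k$ and $\Omega^dM$ have a rank and $$\operatorname{rank}\Omega^d M=\operatorname{rank}\Omega^{d-1}k+1 .$$ (2) Suppose that Buchweitz's question has an affirmative answer for $R$, that is, $$\operatorname{rank}\Omega^d k=\min\{\operatorname{rank}\Omega^d M \mid M \text{ an } R\text{-module of finite length and infinite projective dimension}\}$$ (in particular, the set on the right is non-empty). Then $\Omega^{d-1}k$ and $\Omega^dk$ have a rank and $$\operatorname{rank}\Omega^d k\le\operatorname{rank}\Omega^{d-1}k+1 .$$ -/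

import Mathlib

universe u

open CategoryTheory

/-- A Noetherian local ring is Gorenstein if it has finite injective dimension as a module over
itself. -/
class IsGorensteinLocal (R : Type*) [CommRing R] : Prop extends
    IsLocalRing R, IsNoetherianRing R where
  injectiveDimension_ne_top : injectiveDimension (ModuleCat.of R R) ≠ ⊤

/-- The `R`-module `M` has rank `r`: after inverting all nonzerodivisors of `R`, it becomes free
of rank `r` over the total ring of fractions `Q` of `R`. -/
def HasModuleRank (R : Type*) [CommRing R] (M : Type*) [AddCommGroup M] [Module R M]
    (r : ℕ) : Prop :=
  Nonempty (LocalizedModule (nonZeroDivisors R) M ≃ₗ[Localization (nonZeroDivisors R)]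
    (Fin r → Localization (nonZeroDivisors R)))

/-- The rank of a module over a nonzero ring is unique when it exists. -/
theorem HasModuleRank.unique {R : Type*} [CommRing R] [Nontrivial R] {M : Type*} [AddCommGroup M]
    [Module R M] {r s : ℕ} (hr : HasModuleRank R M r) (hs : HasModuleRank R M s) : r = s := by
  obtain ⟨e⟩ := hr
  obtain ⟨f⟩ := hs
  have : Nontrivial (Localization (nonZeroDivisors R)) :=
    (IsLocalization.injective (M := nonZeroDivisors R) (Localization (nonZeroDivisors R)) le_rfl).nontrivial
  simpa using (e.symm.trans f).finrank_eq

section Syzygy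

variable {R : Type u} [CommRing R]

/-- The minimal number of generators of a finitely generated module. -/
noncomputable def minGenNumber (M : ModuleCat.{u} R) : ℕ :=
  (⊤ : Submodule R M).spanFinrank

/-- A minimal free cover `R ^ n → M` of a finitely generated module `M`: a chosen surjection from
a free module whose rank `n` is the minimal number of generators of `M`. -/
noncomputable def minimalCover (M : ModuleCat.{u} R) : (Fin (minGenNumber M) → R) →ₗ[R] M :=
  Classical.epsilon fun f => Function.Surjective f

/-- The `n`-th syzygy `Ω ^ n M` in the minimal free resolution of a finitely generated module `M`
over a Noetherian local ring: `Ω ^ 0 M = M`, and `Ω ^ (n + 1) M` is the kernel of a minimal free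
cover of `Ω ^ n M`. Splicing these covers gives the minimal free resolution of `M`. -/
noncomputable def syzygy (M : ModuleCat.{u} R) : ℕ → ModuleCat.{u} R
  | 0 => M
  | n + 1 => ModuleCat.of R (LinearMap.ker (minimalCover (syzygy M n)))

theorem minimalCover_surjective (M : ModuleCat.{u} R) [Module.Finite R M] :
    Function.Surjective (minimalCover M) := by
  refine Classical.epsilon_spec (p := fun f : (Fin (minGenNumber M) → R) →ₗ[R] M =>
    Function.Surjective f) ?_
  obtain ⟨s, hs, hspan⟩ := (Module.Finite.fg_top (R := R) (M := M)).exists_span_finset_card_eq_spanFinrank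
  let e : Fin (minGenNumber M) ≃ s := (finCongr hs.symm).trans s.equivFin.symm
  refine ⟨Fintype.linearCombination R (fun i => (e i : M)), ?_⟩
  rw [← LinearMap.range_eq_top, Fintype.range_linearCombination, ← hspan]
  congr 1
  ext x
  constructor
  · rintro ⟨i, rfl⟩
    exact (e i).2
  · intro hx
    exact ⟨e.symm ⟨x, hx⟩, by simp⟩

/-- The cover is minimal: its kernel lies in the maximal ideal times the free module. -/
theorem minimalCover_minimal [IsLocalRing R] (M : ModuleCat.{u} R) [Module.Finite R M]
    (a : Fin (minGenNumber M) → R) (ha : minimalCover M a = 0) (i : Fin (minGenNumber M)) :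
    a i ∈ IsLocalRing.maximalIdeal R := by
  classical
  by_contra hi
  have hu : IsUnit (a i) := by simpa using hi
  let x : Fin (minGenNumber M) → M := fun j => minimalCover M (Pi.single j 1)
  have hx : ∀ b, minimalCover M b = ∑ j, b j • x j := fun b =>
    LinearMap.pi_apply_eq_sum_univ (minimalCover M) b |>.trans (by
      refine Finset.sum_congr rfl fun j _ => ?_
      congr 2
      ext k
      simp [Pi.single_apply, eq_comm])
  let T : Finset M := (Finset.univ.erase i).image x
  have hmem : ∀ j, j ≠ i → x j ∈ Submodule.span R (T : Set M) := fun j hj =>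
    Submodule.subset_span (by
      simp only [T, Finset.coe_image]
      exact ⟨j, by simp [hj], rfl⟩)
  have hxi : x i ∈ Submodule.span R (T : Set M) := by
    have h0 : a i • x i + ∑ j ∈ Finset.univ.erase i, a j • x j = 0 := by
      rw [Finset.add_sum_erase _ (fun j => a j • x j) (Finset.mem_univ i), ← hx, ha]
    have h1 : a i • x i ∈ Submodule.span R (T : Set M) := by
      rw [eq_neg_of_add_eq_zero_left h0]
      exact neg_mem (Submodule.sum_mem _ fun j hj =>
        Submodule.smul_mem _ _ (hmem j (Finset.ne_of_mem_erase hj)))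
    exact (Submodule.smul_mem_iff_of_isUnit _ hu).1 h1
  have htop : Submodule.span R (T : Set M) = ⊤ := by
    refine eq_top_iff.2 fun y _ => ?_
    obtain ⟨b, rfl⟩ := minimalCover_surjective M y
    rw [hx]
    refine Submodule.sum_mem _ fun j _ => Submodule.smul_mem _ _ ?_
    by_cases hj : j = i
    · exact hj ▸ hxi
    · exact hmem j hj
  have h2 : minGenNumber M ≤ T.card := by
    have := Submodule.spanFinrank_span_le_ncard_of_finite (R := R) T.finite_toSet
    rwa [htop, Set.ncard_coe_finset] at this
  have h3 : T.card ≤ minGenNumber M - 1 := by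
    refine Finset.card_image_le.trans ?_
    simp [Finset.card_erase_of_mem]
  have := i.pos
  omega

variable (R) in
/-- For a local ring `R` of dimension `d` with residue field `k`: the rank of `Ω ^ d k` is the
minimum of the ranks of `Ω ^ d M`, where `M` ranges over the `R`-modules of finite length and of
infinite projective dimension. This is an affirmative answer to Buchweitz's question for `R`. -/
def BuchweitzAffirmative [IsLocalRing R] (d : ℕ) : Prop :=
  ∃ s : ℕ, HasModuleRank R (syzygy (ModuleCat.of R (IsLocalRing.ResidueField R)) d) s ∧
    IsLeast {r : ℕ | ∃ M : ModuleCat.{u} R, projectiveDimension M = ⊤ ∧ IsFiniteLength R M ∧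
      HasModuleRank R (syzygy M d) r} s

end Syzygy

/-!
Let `k` be the residue field. The module asked for is the cokernel `M` of a particular embedding
of `k` into a complete intersection of finite length.

Since `R` has finite injective dimension over itself, a maximal regular sequence
`xs = x₁, …, x_d` generates an `𝔪`-primary ideal (`IsGorensteinLocal.exists_isRegular`, from
`eq_maximalIdeal_of_injectiveDimension_ne_top`), and by maximality `k` embeds into `R / (xs)`.
Multiplication by `x₁ ⋯ x_d` embeds `R / (xs)` into `B = R / (x₁², …, x_d²)`. On Koszul complexes
this map is given in degree `i` by products of `d - i` of the `x_j`, so in degrees `i < d` its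
matrices have entries in `𝔪`, and it induces zero on `Ext i (-) k`. The proof avoids Koszul
complexes: it adds the elements one at a time, and each step gains one degree by naturality of the
connecting map (`ModuleCat.exists_isExtNull_of_isWeaklyRegular`).

For the exact sequence `0 → k → B → M → 0` the long exact sequence of `Ext (-) k` therefore breaks
up below degree `d`. Betti numbers are the lengths of `Ext i (-) k`
(`length_ext_eq_minGenNumber_syzygy`), so `β_i(M) = β_i(B) + β_{i-1}(k)` for `i < d`. All three
modules are killed by a nonzerodivisor, so their syzygies have ranks, which are alternating sums of
Betti numbers (`exists_hasModuleRank_syzygy`); hence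
`rank Ω ^ d M = rank Ω ^ d B + rank Ω ^ (d - 1) k`. Here `Ω ^ d B` has rank `1`, because
`β_i(B) = d.choose i`. As `B` has finite projective dimension, `M` has infinite projective dimension
as soon as `k` has. This is `exists_rank_syzygy_eq_add_one`.

If `R` is not regular, then `k` has infinite projective dimension by Serre's theorem
(`isRegularLocalRing_of_projectiveDimension_residueField_ne_top`). If Buchweitz's question has an
affirmative answer, then some module of finite length has infinite projective dimension, so `k` has
too (`projectiveDimension_ne_top_of_isFiniteLength`), and the minimality applies to `M`.
-/

open CategoryTheory.Abelian IsLocalRing RingTheory.Sequence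
open scoped Pointwise

/-! ### Vanishing of `Ext` and finite injective dimension -/

namespace ModuleCat

section Annihilator

variable {R : Type u} [CommRing R]

/-- An element annihilating the second argument annihilates `Ext`. -/
lemma ext_smul_eq_zero_of_mem_annihilator_right {X Y : ModuleCat.{u} R} {r : R}
    (h : r ∈ Module.annihilator R Y) {n : ℕ} (e : Ext X Y n) : r • e = 0 := by
  have h0 : r • 𝟙 Y = 0 := by
    ext y
    exact Module.mem_annihilator.1 h y
  rw [Ext.smul_eq_comp_mk₀, h0, Ext.mk₀_zero, Ext.comp_zero]

/-- An element annihilating the first argument annihilates `Ext`. -/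
lemma ext_smul_eq_zero_of_mem_annihilator_left {X Y : ModuleCat.{u} R} {r : R}
    (h : r ∈ Module.annihilator R X) {n : ℕ} (e : Ext X Y n) : r • e = 0 := by
  have h0 : r • 𝟙 X = 0 := by
    ext y
    exact Module.mem_annihilator.1 h y
  rw [← Ext.mk₀_id_comp (r • e), Ext.comp_smul, ← Ext.smul_comp, ← Ext.mk₀_smul, h0,
    Ext.mk₀_zero, Ext.zero_comp]

lemma mk₀_smulShortComplex_f_comp {N Y : ModuleCat.{u} R} (x : R) {n : ℕ} (e : Ext N Y n) :
    (Ext.mk₀ (N.smulShortComplex x).f).comp e (zero_add n) = x • e := by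
  change (Ext.mk₀ (x • 𝟙 N)).comp e (zero_add n) = x • e
  rw [Ext.mk₀_smul, Ext.smul_comp, Ext.mk₀_id_comp]

lemma comp_mk₀_smulShortComplex_f {N Y : ModuleCat.{u} R} (x : R) {n : ℕ} (e : Ext N Y n) :
    e.comp (Ext.mk₀ (Y.smulShortComplex x).f) (add_zero n) = x • e := by
  change e.comp (Ext.mk₀ (x • 𝟙 Y)) (add_zero n) = x • e
  rw [← Ext.smul_eq_comp_mk₀]

/-- Rees: `Ext` vanishes below the length of a regular sequence on the second argument that
annihilates the first argument. -/
lemma subsingleton_ext_of_isWeaklyRegular (N : ModuleCat.{u} R) (xs : List R) :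
    ∀ (Y : ModuleCat.{u} R), IsWeaklyRegular Y xs → (∀ x ∈ xs, x ∈ Module.annihilator R N) →
      ∀ i < xs.length, Subsingleton (Ext N Y i) := by
  induction xs with
  | nil => intro Y _ _ i hi; simp at hi
  | cons x xs ih =>
    intro Y hreg hann i hi
    rw [isWeaklyRegular_cons_iff] at hreg
    have hS := hreg.1.smulShortComplex_shortExact (M := Y)
    have hx := hann x List.mem_cons_self
    refine subsingleton_of_forall_eq 0 fun e => ?_
    have he : e.comp (Ext.mk₀ (Y.smulShortComplex x).f) (add_zero i) = 0 := by
      exact (comp_mk₀_smulShortComplex_f x e).trans (ext_smul_eq_zero_of_mem_annihilator_left hx e)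
    cases i with
    | zero =>
      have := hS.mono_f
      exact Ext.postcomp_mk₀_injective_of_mono N (Y.smulShortComplex x).f
        (he.trans (map_zero ((Ext.mk₀ (Y.smulShortComplex x).f).postcomp N _)).symm)
    | succ i =>
      obtain ⟨e', rfl⟩ := Ext.covariant_sequence_exact₁ N hS e he (n₀ := i) rfl
      have := ih (ModuleCat.of R (QuotSMulTop x Y)) hreg.2
        (fun y hy => hann y (List.mem_cons_of_mem _ hy)) i (by simpa using hi)
      have he' : e' = 0 := @Subsingleton.elim _ this _ _
      subst he'
      exact Ext.zero_comp ..

end Annihilator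

section Devissage

variable {R : Type u} [CommRing R] [IsLocalRing R]

variable (R) in
/-- The residue field as an object of the category of modules. -/
noncomputable abbrev residueModule : ModuleCat.{u} R := ModuleCat.of R (ResidueField R)

lemma mem_annihilator_residueModule {x : R} (hx : x ∈ maximalIdeal R) :
    x ∈ Module.annihilator R (residueModule R) := by
  refine Module.mem_annihilator.2 fun y => ?_
  change x • (y : ResidueField R) = 0
  rw [Algebra.smul_def, show algebraMap R (ResidueField R) x = 0 from
    (residue_eq_zero_iff x).2 hx, zero_mul]

variable [IsNoetherianRing R]

/-- Nakayama's lemma for the long exact sequence of multiplication by a regular element. -/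
lemma subsingleton_ext_of_quotSMulTop (N Y : ModuleCat.{u} R) [Module.Finite R N]
    [Module.Finite R Y] {x : R} (hx : x ∈ maximalIdeal R) (reg : IsSMulRegular N x) (n : ℕ)
    (h : Subsingleton (Ext (ModuleCat.of R (QuotSMulTop x N)) Y (n + 1))) :
    Subsingleton (Ext N Y n) := by
  have hS := reg.smulShortComplex_shortExact (M := N)
  by_contra! ntr
  have hj : x ∈ (Module.annihilator R (Ext N Y n)).jacobson :=
    (IsLocalRing.maximalIdeal_le_jacobson _) hx
  absurd Submodule.top_ne_pointwise_smul_of_mem_jacobson_annihilator hj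
  rw [eq_comm, eq_top_iff]
  intro y _
  obtain ⟨z, hz⟩ := Ext.contravariant_sequence_exact₁ hS Y y (add_comm 1 n)
    (@Subsingleton.elim _ h _ _)
  rw [hz.symm.trans (mk₀_smulShortComplex_f_comp x z)]
  exact Submodule.smul_mem_pointwise_smul _ _ ⊤ trivial

/-- If `Ext (-) Y` vanishes in degree `n + 1`, it vanishes in degree `n` on the domains `R ⧸ p`
other than the residue field, where some element of the maximal ideal is regular. -/
lemma subsingleton_ext_quotient_prime (Y : ModuleCat.{u} R) [Module.Finite R Y] (n : ℕ)
    (h : ∀ N : ModuleCat.{u} R, Module.Finite R N → Subsingleton (Ext N Y (n + 1)))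
    (p : Ideal R) [p.IsPrime] (hp : p ≠ maximalIdeal R) :
    Subsingleton (Ext (ModuleCat.of R (R ⧸ p)) Y n) := by
  obtain ⟨x, hxm, hxp⟩ : ∃ x ∈ maximalIdeal R, x ∉ p := by
    by_contra! hc
    exact hp (le_antisymm (le_maximalIdeal (Ideal.IsPrime.ne_top ‹_›)) hc)
  refine subsingleton_ext_of_quotSMulTop _ Y hxm ?_ n (h _ ?_)
  · change IsSMulRegular (R ⧸ p) x
    rw [isSMulRegular_quotient_iff_mem_of_smul_mem]
    intro y hy
    exact ((Ideal.IsPrime.mem_or_mem ‹_›) hy).resolve_left hxp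
  · change Module.Finite R (QuotSMulTop x (R ⧸ p))
    infer_instance

/-- If `Ext (-) Y` vanishes in degree `n + 1`, its vanishing in degree `n` has to be tested on
the residue field only. -/
lemma subsingleton_ext_of_residueField (Y : ModuleCat.{u} R) [Module.Finite R Y] (n : ℕ)
    (h : ∀ N : ModuleCat.{u} R, Module.Finite R N → Subsingleton (Ext N Y (n + 1)))
    (hk : Subsingleton (Ext (residueModule R) Y n))
    (N : ModuleCat.{u} R) [Module.Finite R N] : Subsingleton (Ext N Y n) := by
  have key : ∀ (A B : ModuleCat.{u} R) (e : A ≅ B), Subsingleton (Ext B Y n) →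
      Subsingleton (Ext A Y n) := by
    intro A B e hB
    refine subsingleton_of_forall_eq 0 fun x => ?_
    rw [← Ext.mk₀_id_comp x, ← e.hom_inv_id, ← Ext.mk₀_comp_mk₀_assoc,
      @Subsingleton.elim _ hB ((Ext.mk₀ e.inv).comp x (zero_add n)) 0, Ext.comp_zero]
  refine IsNoetherianRing.induction_on_isQuotientEquivQuotientPrime (A := R) (M := N)
    inferInstance (motive := fun M _ _ _ => Subsingleton (Ext (ModuleCat.of R M) Y n))
    ?_ ?_ ?_
  · intro M _ _ _ _
    have : Limits.IsZero (ModuleCat.of R M) := ModuleCat.isZero_of_subsingleton _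
    have := this.hasProjectiveDimensionLT_zero
    exact HasProjectiveDimensionLT.subsingleton _ 0 n (Nat.zero_le _) Y
  · intro M _ _ _ p e
    refine key _ _ e.toModuleIso ?_
    by_cases hp : p.asIdeal = maximalIdeal R
    · rw [hp]; exact hk
    · exact subsingleton_ext_quotient_prime Y n h p.asIdeal hp
  · intro M₁ _ _ _ M₂ _ _ _ M₃ _ _ _ f g hf hg hfg h₁ h₃
    let S : ShortComplex (ModuleCat.{u} R) :=
      ModuleCat.shortComplexOfCompEqZero f g hfg.linearMap_comp_eq_zero
    have hS : S.ShortExact := ModuleCat.shortComplex_shortExact S hfg hf hg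
    refine subsingleton_of_forall_eq 0 fun x => ?_
    obtain ⟨y, rfl⟩ := Ext.contravariant_sequence_exact₂ hS Y x (@Subsingleton.elim _ h₁ _ _)
    rw [@Subsingleton.elim _ h₃ y 0, Ext.comp_zero]

end Devissage

end ModuleCat

section CohenMacaulay

variable {R : Type u} [CommRing R] [IsLocalRing R] [IsNoetherianRing R]

lemma exists_ringKrullDim_eq_natCast (R : Type u) [CommRing R] [IsLocalRing R]
    [IsNoetherianRing R] : ∃ d : ℕ, ringKrullDim R = d := by
  have h1 := ringKrullDim_ne_bot (R := R)
  have h2 := ringKrullDim_ne_top (R := R)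
  generalize ringKrullDim R = D at *
  induction D with
  | bot => simp at h1
  | coe D =>
    induction D with
    | top => simp at h2
    | coe n => exact ⟨n, rfl⟩

/-- There is a regular sequence modulo which the ring contains a copy of the residue field: any
regular sequence of maximal length will do. -/
lemma exists_isRegular_residueField_embedding (R : Type u) [CommRing R] [IsLocalRing R]
    [IsNoetherianRing R] :
    ∃ xs : List R, IsRegular R xs ∧ (∀ x ∈ xs, x ∈ maximalIdeal R) ∧
      ∃ f : ResidueField R →ₗ[R] R ⧸ Ideal.ofList xs • (⊤ : Submodule R R),
        Function.Injective f := by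
  classical
  have hmem : ∀ xs : List R, IsRegular R xs → ∀ x ∈ xs, x ∈ maximalIdeal R := by
    intro xs hxs x hx
    apply le_maximalIdeal (J := Ideal.ofList xs)
    · simpa using hxs.2.symm
    · exact Ideal.subset_span (by simpa using hx)
  obtain ⟨d, hd⟩ := exists_ringKrullDim_eq_natCast R
  have hle : ∀ xs : List R, IsRegular R xs → xs.length ≤ d := by
    intro xs hxs
    have h := ringKrullDim_add_length_eq_ringKrullDim_of_isRegular xs hxs
    rw [hd] at h
    have h0 : 0 ≤ ringKrullDim (R ⧸ Ideal.ofList xs) := by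
      have : Nontrivial (R ⧸ Ideal.ofList xs) := Ideal.Quotient.nontrivial_iff.2 (by
        simpa using hxs.2.symm)
      exact ringKrullDim_nonneg_of_nontrivial
    have : ((xs.length : ℕ) : WithBot ℕ∞) ≤ d := by
      rw [← h]; exact le_add_of_nonneg_left h0
    exact_mod_cast this
  let P : ℕ → Prop := fun n => ∃ xs : List R, IsRegular R xs ∧ xs.length = n
  have hP0 : P 0 := ⟨[], IsRegular.nil R R, rfl⟩
  obtain ⟨xs, hxs, hlen⟩ : P (Nat.findGreatest P d) := Nat.findGreatest_spec (Nat.zero_le _) hP0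
  refine ⟨xs, hxs, hmem xs hxs, ?_⟩
  have hns : ¬ Subsingleton
      (ResidueField R →ₗ[R] R ⧸ Ideal.ofList xs • (⊤ : Submodule R R)) := by
    rw [IsSMulRegular.subsingleton_linearMap_iff]
    rintro ⟨r, hr, hreg⟩
    have hrm : r ∈ maximalIdeal R := by
      have h1 := Module.mem_annihilator.1 hr 1
      rw [Algebra.smul_def, mul_one] at h1
      exact (residue_eq_zero_iff r).1 h1
    have : IsRegular R (xs ++ [r]) := by
      rw [IsLocalRing.isRegular_iff_isWeaklyRegular_of_subset_maximalIdeal,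
        isWeaklyRegular_append_iff, isWeaklyRegular_singleton_iff]
      · exact ⟨hxs.1, hreg⟩
      · simpa [or_imp, forall_and] using ⟨hmem xs hxs, hrm⟩
    have h1 := Nat.le_findGreatest (P := P) (hle _ this) ⟨_, this, rfl⟩
    rw [← hlen] at h1
    simp at h1
  rw [not_subsingleton_iff_nontrivial] at hns
  obtain ⟨f, hf⟩ := exists_ne (0 : ResidueField R →ₗ[R] R ⧸ Ideal.ofList xs • (⊤ : Submodule R R))
  have : IsSimpleModule R (ResidueField R) :=
    isSimpleModule_iff_isCoatom.2 (Ideal.isMaximal_def.1 inferInstance)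
  refine ⟨f, (LinearMap.injective_or_eq_zero f).resolve_right hf⟩

open ModuleCat

/-- Over a local ring of finite injective dimension, a maximal regular sequence is a system of
parameters: only the maximal ideal contains it. Indeed `Ext (-) R` vanishes above the length of the
sequence, and in that degree it is nonzero on `k` and zero on `R / p` for every other prime `p`. -/
lemma eq_maximalIdeal_of_injectiveDimension_ne_top
    (hinj : injectiveDimension (ModuleCat.of R R) ≠ ⊤) {xs : List R} (hreg : IsRegular R xs)
    (hmem : ∀ x ∈ xs, x ∈ maximalIdeal R)
    (f : ResidueField R →ₗ[R] R ⧸ Ideal.ofList xs • (⊤ : Submodule R R))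
    (hf : Function.Injective f) (p : Ideal R) [p.IsPrime] (hp : Ideal.ofList xs ≤ p) :
    p = maximalIdeal R := by
  set Y := ModuleCat.of R R
  have : Module.Finite R Y := inferInstanceAs (Module.Finite R R)
  set B := ModuleCat.of R (R ⧸ Ideal.ofList xs • (⊤ : Submodule R R))
  set k := residueModule R
  have : Module.Finite R k := inferInstanceAs (Module.Finite R (ResidueField R))
  obtain ⟨c, hc⟩ := (injectiveDimension_ne_top_iff Y).1 hinj
  have hB : HasProjectiveDimensionLE B xs.length := by
    rw [← projectiveDimension_le_iff]
    have := projectiveDimension_quotient_eq_add_length_of_isWeaklyRegular Y xs hreg.1 hmem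
    have h0 : projectiveDimension Y = 0 := projectiveDimension_eq_zero_of_projective Y
    rw [h0, zero_add] at this
    exact this.le
  -- Vanishing above the length of the sequence, by descending induction from the injective
  -- dimension: the classes on `k` extend along `f` to classes on `B`, which has finite
  -- projective dimension.
  have high : ∀ j n : ℕ, xs.length < n → c < n + j → ∀ N : ModuleCat.{u} R, Module.Finite R N →
      Subsingleton (Ext N Y n) := by
    intro j
    induction j with
    | zero => intro n _ hn N _; exact HasInjectiveDimensionLT.subsingleton Y (c + 1) n hn N
    | succ j ih =>
      intro n hn hcn N _
      have hsucc := ih (n + 1) (by omega) (by omega)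
      refine subsingleton_ext_of_residueField Y n hsucc ?_ N
      let S : ShortComplex (ModuleCat.{u} R) :=
        ModuleCat.shortComplexOfCompEqZero f (LinearMap.range f).mkQ
          f.exact_map_mkQ_range.linearMap_comp_eq_zero
      have hS : S.ShortExact := ModuleCat.shortComplex_shortExact S
        f.exact_map_mkQ_range hf (Submodule.mkQ_surjective _)
      have : Module.Finite R S.X₃ := inferInstanceAs (Module.Finite R (_ ⧸ LinearMap.range f))
      refine subsingleton_of_forall_eq 0 fun x => ?_
      obtain ⟨y, rfl⟩ := Ext.contravariant_sequence_exact₁ hS Y x (add_comm 1 n)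
        (@Subsingleton.elim _ (hsucc S.X₃ this) _ _)
      have hy : y = 0 := @Subsingleton.elim _
        (HasProjectiveDimensionLT.subsingleton B (xs.length + 1) n hn Y) _ _
      rw [hy, Ext.comp_zero]
  have hk : ¬ Subsingleton (Ext k Y xs.length) := by
    intro hk
    -- otherwise `Ext (-) R` vanishes in all degrees, including `Ext 0 R R`
    have low : ∀ j n : ℕ, n + j = xs.length → ∀ N : ModuleCat.{u} R, Module.Finite R N →
        Subsingleton (Ext N Y n) := by
      intro j
      induction j with
      | zero =>
        intro n hn N _
        obtain rfl : n = xs.length := by omega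
        exact subsingleton_ext_of_residueField Y _ (high (c + 1) _ (by omega) (by omega)) hk N
      | succ j ih =>
        intro n hn N _
        exact subsingleton_ext_of_residueField Y n (ih (n + 1) (by omega))
          (subsingleton_ext_of_isWeaklyRegular k xs Y hreg.1
            (fun x hx => mem_annihilator_residueModule (hmem x hx)) n (by omega)) N
    have h0 : Subsingleton (Y ⟶ Y) :=
      Ext.homEquiv₀.subsingleton_congr.mp (low xs.length 0 (by omega) Y inferInstance)
    have h1 : 𝟙 Y = 0 := Subsingleton.elim _ _
    have h2 : (1 : R) = 0 := by
      have := congrArg (fun φ : Y ⟶ Y => φ.hom (1 : R)) h1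
      exact this
    exact one_ne_zero h2
  -- If `p ≠ 𝔪`, the surjection `R / p → k` embeds `Ext (length) k R` into
  -- `Ext (length) (R / p) R = 0`, since `Ext` of its kernel vanishes one degree lower.
  by_contra hpm
  have hRp := subsingleton_ext_quotient_prime Y xs.length
    (high (c + 1) _ (by omega) (by omega)) p hpm
  have hple : p ≤ maximalIdeal R := le_maximalIdeal (Ideal.IsPrime.ne_top ‹_›)
  let q : (R ⧸ p) →ₗ[R] ResidueField R :=
    (Ideal.Quotient.factorₐ R hple).toLinearMap
  have hq : Function.Surjective q := Ideal.Quotient.factor_surjective hple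
  let S : ShortComplex (ModuleCat.{u} R) := q.shortComplexKer
  have hS : S.ShortExact := LinearMap.shortExact_shortComplexKer hq
  refine hk (subsingleton_of_forall_eq 0 fun x => ?_)
  have hx : (Ext.mk₀ S.g).comp x (zero_add _) = 0 := @Subsingleton.elim _ hRp _ _
  rcases Nat.eq_zero_or_eq_succ_pred xs.length with hl | hl
  · generalize xs.length = t at *
    subst hl
    have := hS.epi_g
    exact Ext.precomp_mk₀_injective_of_epi Y S.g (by simpa using hx)
  · obtain ⟨y, rfl⟩ := Ext.contravariant_sequence_exact₃ hS Y x hx (n₀ := xs.length.pred)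
      (by omega)
    have : Subsingleton (Ext S.X₁ Y xs.length.pred) := by
      refine subsingleton_ext_of_isWeaklyRegular S.X₁ xs Y hreg.1 ?_ _ (by omega)
      intro x hx
      refine Module.mem_annihilator.2 fun y => ?_
      apply Subtype.ext
      change x • (y : R ⧸ p) = 0
      rw [Algebra.smul_def, show algebraMap R (R ⧸ p) x = 0 from
        Ideal.Quotient.eq_zero_iff_mem.2 (hp (Ideal.subset_span (by simpa using hx))), zero_mul]
    rw [Subsingleton.elim y 0, Ext.comp_zero]

end CohenMacaulay

/-! ### Regular sequences and squares of their elements -/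

/-- Weak regularity passes to extensions. -/
lemma RingTheory.Sequence.IsWeaklyRegular.of_exact {R : Type u} [CommRing R] (xs : List R) :
    ∀ {M M' M'' : Type u} [AddCommGroup M] [Module R M] [AddCommGroup M'] [Module R M']
      [AddCommGroup M''] [Module R M''] (f : M →ₗ[R] M') (g : M' →ₗ[R] M''),
      Function.Injective f → Function.Exact f g → Function.Surjective g →
      IsWeaklyRegular M xs → IsWeaklyRegular M'' xs → IsWeaklyRegular M' xs := by
  induction xs with
  | nil => intros; exact IsWeaklyRegular.nil R _
  | cons x xs ih =>
    intro M M' M'' _ _ _ _ _ _ f g hf hfg hg h1 h2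
    rw [isWeaklyRegular_cons_iff] at h1 h2 ⊢
    refine ⟨isSMulRegular_of_range_eq_ker hf (LinearMap.exact_iff.1 hfg).symm h1.1 h2.1,
      ih (QuotSMulTop.map x f) (QuotSMulTop.map x g) ?_ (QuotSMulTop.map_exact x hfg hg)
        (QuotSMulTop.map_surjective x hg) h1.2 h2.2⟩
    have h0 : Function.Exact (0 : M →ₗ[R] M) f := by
      rw [LinearMap.exact_iff, LinearMap.ker_eq_bot.2 hf, LinearMap.range_zero]
    have h := QuotSMulTop.map_first_exact_on_four_term_exact_of_isSMulRegular_last h0 hfg h2.1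
    rw [map_zero, LinearMap.exact_iff, LinearMap.range_zero] at h
    exact LinearMap.ker_eq_bot.1 h

section SquareStep

variable {R : Type u} [CommRing R] {N N' : Type u} [AddCommGroup N] [Module R N]
  [AddCommGroup N'] [Module R N'] (g : N →ₗ[R] N') (x : R)

/-- The map `N / x N → N' / x ^ 2 N'` induced by `x • g`. Starting from the identity of `R` and
iterating along a regular sequence, it gives the map `R / (xs) → R / (xs ^ 2)` of multiplication
by the product of the elements of the sequence. -/
def squareStep : QuotSMulTop x N →ₗ[R] QuotSMulTop (x ^ 2) N' :=
  Submodule.mapQ _ _ (x • g) (by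
    rintro _ hn
    obtain ⟨n, -, rfl⟩ := (Submodule.mem_smul_pointwise_iff_exists _ _ _).1 hn
    refine (Submodule.mem_smul_pointwise_iff_exists _ _ _).2 ⟨g n, trivial, ?_⟩
    simp [pow_two, mul_smul])

lemma squareStep_mk (n : N) :
    squareStep g x (Submodule.Quotient.mk n) = Submodule.Quotient.mk (x • g n) := rfl

lemma quotSMulTop_mk_eq_zero_iff {M : Type u} [AddCommGroup M] [Module R M] (r : R) (m : M) :
    (Submodule.Quotient.mk m : QuotSMulTop r M) = 0 ↔ ∃ m', r • m' = m := by
  rw [Submodule.Quotient.mk_eq_zero, Submodule.mem_smul_pointwise_iff_exists]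
  simp

variable {g x}

lemma squareStep_injective (hg : Function.Injective g) (hx : IsSMulRegular N' x)
    (hC : IsSMulRegular (N' ⧸ LinearMap.range g) x) : Function.Injective (squareStep g x) := by
  rw [injective_iff_map_eq_zero]
  intro q hq
  obtain ⟨n, rfl⟩ := Submodule.Quotient.mk_surjective _ q
  rw [squareStep_mk, quotSMulTop_mk_eq_zero_iff] at hq
  obtain ⟨n', hn'⟩ := hq
  have h1 : x • n' = g n := hx (by simpa [pow_two, mul_smul] using hn')
  obtain ⟨n'', rfl⟩ : n' ∈ LinearMap.range g := by
    rw [isSMulRegular_quotient_iff_mem_of_smul_mem] at hC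
    exact hC n' ⟨n, h1.symm⟩
  rw [quotSMulTop_mk_eq_zero_iff]
  exact ⟨n'', hg (by rw [map_smul, h1])⟩

/-- The square of a regular element may replace the first element of a regular sequence: the
quotient by the square is an extension of two copies of the quotient. -/
lemma isWeaklyRegular_quotSMulTop_sq {xs : List R} (hx : IsSMulRegular N' x)
    (h : IsWeaklyRegular (QuotSMulTop x N') xs) :
    IsWeaklyRegular (QuotSMulTop (x ^ 2) N') xs := by
  let β : QuotSMulTop (x ^ 2) N' →ₗ[R] QuotSMulTop x N' :=
    Submodule.liftQ _ (Submodule.mkQ _) (by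
      rintro _ hn
      obtain ⟨n, -, rfl⟩ := (Submodule.mem_smul_pointwise_iff_exists _ _ _).1 hn
      exact (quotSMulTop_mk_eq_zero_iff x _).2 ⟨x • n, by rw [pow_two, mul_smul]⟩)
  have hβ : ∀ n, β (Submodule.Quotient.mk n) = Submodule.Quotient.mk n := fun _ => rfl
  refine IsWeaklyRegular.of_exact xs (squareStep (LinearMap.id : N' →ₗ[R] N') x) β
    (squareStep_injective Function.injective_id hx ?_) ?_ ?_ h h
  · rw [isSMulRegular_quotient_iff_mem_of_smul_mem]
    intro y _
    exact ⟨y, rfl⟩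
  · intro q
    obtain ⟨n, rfl⟩ := Submodule.Quotient.mk_surjective _ q
    rw [hβ, quotSMulTop_mk_eq_zero_iff]
    constructor
    · rintro ⟨n', rfl⟩
      exact ⟨Submodule.Quotient.mk n', rfl⟩
    · rintro ⟨q', hq'⟩
      obtain ⟨n', rfl⟩ := Submodule.Quotient.mk_surjective _ q'
      rw [squareStep_mk, ← sub_eq_zero, ← Submodule.Quotient.mk_sub,
        quotSMulTop_mk_eq_zero_iff] at hq'
      obtain ⟨m, hm⟩ := hq'
      refine ⟨n' - x • m, ?_⟩
      rw [smul_sub, ← mul_smul, ← pow_two, hm]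
      simp
  · intro q
    obtain ⟨n, rfl⟩ := Submodule.Quotient.mk_surjective _ q
    exact ⟨Submodule.Quotient.mk n, rfl⟩

/-- The cokernel of `squareStep g x` is an extension of `N' / x N'` by `C / x C`, where `C` is the
cokernel of `g`. -/
lemma isWeaklyRegular_coker_squareStep {xs : List R} (hx : IsSMulRegular N' x)
    (h : IsWeaklyRegular (QuotSMulTop x N') xs)
    (hC : IsWeaklyRegular (QuotSMulTop x (N' ⧸ LinearMap.range g)) xs) :
    IsWeaklyRegular (QuotSMulTop (x ^ 2) N' ⧸ LinearMap.range (squareStep g x)) xs := by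
  let α₀ : N' →ₗ[R] QuotSMulTop (x ^ 2) N' ⧸ LinearMap.range (squareStep g x) :=
    x • ((LinearMap.range (squareStep g x)).mkQ ∘ₗ Submodule.mkQ _)
  have hα₀ : ∀ n, α₀ n = Submodule.Quotient.mk (Submodule.Quotient.mk (x • n)) := fun _ => rfl
  let α₁ : (N' ⧸ LinearMap.range g) →ₗ[R]
      QuotSMulTop (x ^ 2) N' ⧸ LinearMap.range (squareStep g x) :=
    Submodule.liftQ _ α₀ (by
      rintro _ ⟨n, rfl⟩
      rw [LinearMap.mem_ker, hα₀, Submodule.Quotient.mk_eq_zero]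
      exact ⟨Submodule.Quotient.mk n, rfl⟩)
  have hα₁ : ∀ n, α₁ (Submodule.Quotient.mk n) =
    Submodule.Quotient.mk (Submodule.Quotient.mk (x • n)) := fun _ => rfl
  let α : QuotSMulTop x (N' ⧸ LinearMap.range g) →ₗ[R]
      QuotSMulTop (x ^ 2) N' ⧸ LinearMap.range (squareStep g x) :=
    Submodule.liftQ _ α₁ (by
      rintro _ hn
      obtain ⟨c, -, rfl⟩ := (Submodule.mem_smul_pointwise_iff_exists _ _ _).1 hn
      obtain ⟨n, rfl⟩ := Submodule.Quotient.mk_surjective _ c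
      rw [LinearMap.mem_ker, ← Submodule.Quotient.mk_smul, hα₁,
        (quotSMulTop_mk_eq_zero_iff (x ^ 2) (x • x • n)).2 ⟨n, by rw [pow_two, mul_smul]⟩,
        Submodule.Quotient.mk_zero])
  have hα : ∀ n, α (Submodule.Quotient.mk (Submodule.Quotient.mk n)) =
    Submodule.Quotient.mk (Submodule.Quotient.mk (x • n)) := fun _ => rfl
  let β : (QuotSMulTop (x ^ 2) N' ⧸ LinearMap.range (squareStep g x)) →ₗ[R] QuotSMulTop x N' :=
    Submodule.liftQ _ (Submodule.liftQ _ (Submodule.mkQ _) (by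
      rintro _ hn
      obtain ⟨n, -, rfl⟩ := (Submodule.mem_smul_pointwise_iff_exists _ _ _).1 hn
      exact (quotSMulTop_mk_eq_zero_iff x _).2 ⟨x • n, by rw [pow_two, mul_smul]⟩)) (by
      rintro _ ⟨q, rfl⟩
      obtain ⟨n, rfl⟩ := Submodule.Quotient.mk_surjective _ q
      exact (quotSMulTop_mk_eq_zero_iff x _).2 ⟨g n, rfl⟩)
  have hβ : ∀ n, β (Submodule.Quotient.mk (Submodule.Quotient.mk n)) =
    Submodule.Quotient.mk n := fun _ => rfl
  refine IsWeaklyRegular.of_exact xs α β ?_ ?_ ?_ hC h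
  · rw [injective_iff_map_eq_zero]
    intro q hq
    obtain ⟨c, rfl⟩ := Submodule.Quotient.mk_surjective _ q
    obtain ⟨n, rfl⟩ := Submodule.Quotient.mk_surjective _ c
    rw [hα, Submodule.Quotient.mk_eq_zero] at hq
    obtain ⟨q', hq'⟩ := hq
    obtain ⟨n', rfl⟩ := Submodule.Quotient.mk_surjective _ q'
    rw [squareStep_mk, ← sub_eq_zero, ← Submodule.Quotient.mk_sub,
      quotSMulTop_mk_eq_zero_iff] at hq'
    obtain ⟨m, hm⟩ := hq'
    have h1 : x • m = g n' - n := hx (by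
      simpa [pow_two, mul_smul, smul_sub] using hm)
    rw [quotSMulTop_mk_eq_zero_iff]
    refine ⟨Submodule.Quotient.mk (-m), ?_⟩
    rw [← Submodule.Quotient.mk_smul, Submodule.Quotient.eq]
    refine ⟨-n', ?_⟩
    rw [smul_neg, h1, map_neg]
    abel
  · intro q
    obtain ⟨c, rfl⟩ := Submodule.Quotient.mk_surjective _ q
    obtain ⟨n, rfl⟩ := Submodule.Quotient.mk_surjective _ c
    rw [hβ, quotSMulTop_mk_eq_zero_iff]
    constructor
    · rintro ⟨n', rfl⟩
      exact ⟨Submodule.Quotient.mk (Submodule.Quotient.mk n'), rfl⟩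
    · rintro ⟨q', hq'⟩
      obtain ⟨c, rfl⟩ := Submodule.Quotient.mk_surjective _ q'
      obtain ⟨n', rfl⟩ := Submodule.Quotient.mk_surjective _ c
      have := congrArg β hq'
      rw [hα, hβ, hβ] at this
      exact (quotSMulTop_mk_eq_zero_iff x n).1
        (this ▸ (quotSMulTop_mk_eq_zero_iff x _).2 ⟨n', rfl⟩)
  · intro q
    obtain ⟨n, rfl⟩ := Submodule.Quotient.mk_surjective _ q
    exact ⟨Submodule.Quotient.mk (Submodule.Quotient.mk n), rfl⟩

end SquareStep

/-! ### Maps inducing zero on `Ext` into the residue field -/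

namespace ModuleCat

section ExtLength

variable {R : Type u} [CommRing R] {S : ShortComplex (ModuleCat.{u} R)} (hS : S.ShortExact)
  (Y : ModuleCat.{u} R)

include hS in
lemma length_ext_zero_of_comp_eq_zero
    (h : ∀ e : Ext S.X₂ Y 0, (Ext.mk₀ S.f).comp e (zero_add 0) = 0) :
    Module.length R (Ext S.X₃ Y 0) = Module.length R (Ext S.X₂ Y 0) := by
  have := hS.epi_g
  refine (LinearEquiv.ofBijective
    ((Ext.mk₀ S.g).precompOfLinear R Y (zero_add 0)) ⟨?_, fun e => ?_⟩).length_eq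
  · exact Ext.precomp_mk₀_injective_of_epi Y S.g
  · exact Ext.contravariant_sequence_exact₂ hS Y e (h e)

include hS in
/-- If the first map of a short exact sequence induces zero on `Ext (-) Y` in two consecutive
degrees, then the long exact sequence breaks up there. -/
lemma length_ext_succ_of_comp_eq_zero (i : ℕ)
    (h₀ : ∀ e : Ext S.X₂ Y i, (Ext.mk₀ S.f).comp e (zero_add i) = 0)
    (h₁ : ∀ e : Ext S.X₂ Y (i + 1), (Ext.mk₀ S.f).comp e (zero_add (i + 1)) = 0) :
    Module.length R (Ext S.X₃ Y (i + 1)) =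
      Module.length R (Ext S.X₁ Y i) + Module.length R (Ext S.X₂ Y (i + 1)) := by
  refine Module.length_eq_add_of_exact (hS.extClass.precompOfLinear R Y (add_comm 1 i))
    ((Ext.mk₀ S.g).precompOfLinear R Y (zero_add (i + 1))) ?_ ?_ ?_
  · rw [injective_iff_map_eq_zero]
    intro e he
    obtain ⟨e', rfl⟩ := Ext.contravariant_sequence_exact₁ hS Y e (add_comm 1 i) he
    exact h₀ e'
  · intro e
    exact Ext.contravariant_sequence_exact₂ hS Y e (h₁ e)
  · intro e
    constructor
    · exact fun he => Ext.contravariant_sequence_exact₃ hS Y e he (add_comm 1 i)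
    · rintro ⟨e', rfl⟩
      exact hS.comp_extClass_assoc e' (add_comm 1 i)

end ExtLength

section ResidueField

variable {R : Type u} [CommRing R] [IsLocalRing R]

lemma mk₀_smulShortComplex_f_comp_eq_zero {N : ModuleCat.{u} R} {x : R}
    (hx : x ∈ maximalIdeal R) {n : ℕ} (e : Ext N (residueModule R) n) :
    (Ext.mk₀ (N.smulShortComplex x).f).comp e (zero_add n) = 0 :=
  (mk₀_smulShortComplex_f_comp x e).trans
    (ext_smul_eq_zero_of_mem_annihilator_right (mem_annihilator_residueModule hx) e)

/-- Pascal's rule for the Koszul Betti numbers of a quotient by a regular sequence. -/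
lemma length_ext_quotSMulTop {N : ModuleCat.{u} R} {x : R} (hx : x ∈ maximalIdeal R)
    (reg : IsSMulRegular N x) {n : ℕ}
    (h : ∀ i, Module.length R (Ext N (residueModule R) i) = n.choose i) (i : ℕ) :
    Module.length R (Ext (ModuleCat.of R (QuotSMulTop x N)) (residueModule R) i) =
      (n + 1).choose i := by
  have hS := reg.smulShortComplex_shortExact (M := N)
  cases i with
  | zero =>
    have := length_ext_zero_of_comp_eq_zero hS (residueModule R)
      (fun e => mk₀_smulShortComplex_f_comp_eq_zero hx e)
    refine this.trans ((h 0).trans (by simp))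
  | succ i =>
    have := length_ext_succ_of_comp_eq_zero hS (residueModule R) i
      (fun e => mk₀_smulShortComplex_f_comp_eq_zero hx e)
      (fun e => mk₀_smulShortComplex_f_comp_eq_zero hx e)
    refine this.trans ((congrArg₂ (· + ·) (h i) (h (i + 1))).trans ?_)
    rw [Nat.choose_succ_succ]
    push_cast
    rfl

/-- A map of modules that induces zero on `Ext (-) k` in degrees below `n`, where `k` is the
residue field. Equivalently, in degrees below `n` it lifts to a map of minimal free resolutions
whose matrices have entries in the maximal ideal. -/
def IsExtNull {N N' : ModuleCat.{u} R} (g : N ⟶ N') (n : ℕ) : Prop :=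
  ∀ i < n, ∀ e : Ext N' (residueModule R) i, (Ext.mk₀ g).comp e (zero_add i) = 0

lemma IsExtNull.precomp {L N N' : ModuleCat.{u} R} {g : N ⟶ N'} {n : ℕ} (h : IsExtNull g n)
    (f : L ⟶ N) : IsExtNull (f ≫ g) n := by
  intro i hi e
  rw [← Ext.mk₀_comp_mk₀_assoc, h i hi e, Ext.comp_zero]

/-- A map on the third terms of short exact sequences, followed by a map `s` which is null after
pulling back to the second term, is null in one degree more than the map on the first terms. -/
lemma IsExtNull.τ₃_comp {S S' : ShortComplex (ModuleCat.{u} R)} (hS : S.ShortExact)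
    (hS' : S'.ShortExact) (φ : S ⟶ S') {Z : ModuleCat.{u} R} (s : S'.X₃ ⟶ Z) {n : ℕ}
    (h : IsExtNull φ.τ₁ n) (hs : IsExtNull (S'.g ≫ s) (n + 1)) :
    IsExtNull (φ.τ₃ ≫ s) (n + 1) := by
  intro i hi e
  have hu : (Ext.mk₀ S'.g).comp ((Ext.mk₀ s).comp e (zero_add i)) (zero_add i) = 0 := by
    rw [Ext.mk₀_comp_mk₀_assoc]
    exact hs i hi e
  rw [← Ext.mk₀_comp_mk₀_assoc]
  generalize (Ext.mk₀ s).comp e (zero_add i) = v at hu ⊢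
  cases i with
  | zero =>
    have := hS'.epi_g
    have hv : v = 0 := Ext.precomp_mk₀_injective_of_epi _ S'.g
      (hu.trans (map_zero ((Ext.mk₀ S'.g).precomp _ _)).symm)
    rw [hv, Ext.comp_zero]
  | succ i =>
    -- `v` is the image of some `w` under the connecting map, which is natural
    obtain ⟨w, rfl⟩ := Ext.contravariant_sequence_exact₃ hS' _ v hu (add_comm 1 i)
    rw [← Ext.comp_assoc (a₁₂ := 1) _ _ _ (by omega) (by omega) (by omega),
      ← ShortComplex.ShortExact.extClass_naturality hS hS' φ,
      Ext.comp_assoc (a₂₃ := i) _ _ _ (by omega) (by omega) (by omega),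
      h i (by omega) w, Ext.comp_zero]

lemma isExtNull_smul {N N' : ModuleCat.{u} R} (g : N ⟶ N') {x : R} (hx : x ∈ maximalIdeal R)
    (n : ℕ) : IsExtNull (x • g) n := by
  intro i _ e
  rw [Ext.mk₀_smul, Ext.smul_comp]
  exact ext_smul_eq_zero_of_mem_annihilator_right (mem_annihilator_residueModule hx) _

/-- Passing to `squareStep` gains one degree: it is the map induced by `g` modulo `x`, followed by
a map that becomes a multiple of `x` on `N'`. -/
lemma IsExtNull.squareStep {N N' : ModuleCat.{u} R} {g : N ⟶ N'} {n : ℕ} (h : IsExtNull g n)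
    {x : R} (hx : x ∈ maximalIdeal R) (hN : IsSMulRegular N x) (hN' : IsSMulRegular N' x) :
    IsExtNull (ModuleCat.ofHom (squareStep g.hom x)) (n + 1) := by
  let φ : N.smulShortComplex x ⟶ N'.smulShortComplex x :=
    { τ₁ := g
      τ₂ := g
      τ₃ := ModuleCat.ofHom (QuotSMulTop.map x g.hom)
      comm₁₂ := by
        ext n
        exact (map_smul g.hom x n).symm
      comm₂₃ := rfl }
  have hs := isExtNull_smul (N := N') (N' := ModuleCat.of R (QuotSMulTop (x ^ 2) N'))
    (ModuleCat.ofHom (Submodule.mkQ _)) hx (n + 1)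
  have key := IsExtNull.τ₃_comp (hN.smulShortComplex_shortExact (M := N))
    (hN'.smulShortComplex_shortExact (M := N')) φ
    (ModuleCat.ofHom (_root_.squareStep (LinearMap.id : N' →ₗ[R] N') x)) h hs
  have hfac : ModuleCat.ofHom (_root_.squareStep g.hom x) =
      ModuleCat.ofHom (_root_.squareStep (LinearMap.id : N' →ₗ[R] N') x ∘ₗ
        QuotSMulTop.map x g.hom) := by
    congr 1
    refine LinearMap.ext fun q => ?_
    obtain ⟨m, rfl⟩ := Submodule.Quotient.mk_surjective (x • (⊤ : Submodule R N)) q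
    rfl
  rw [hfac]
  exact key

/-- Iterating `squareStep` along a regular sequence `xs` gives an embedding of `N / (xs) N` into
a module `B = N' / (xs ^ 2) N'` which is null in as many further degrees as `xs` has elements. -/
lemma exists_isExtNull_of_isWeaklyRegular (xs : List R) (hxs : ∀ x ∈ xs, x ∈ maximalIdeal R) :
    ∀ {N N' : ModuleCat.{u} R} (g : N ⟶ N') (n : ℕ), Module.Finite R N' →
      IsWeaklyRegular N xs → IsWeaklyRegular N' xs →
      IsWeaklyRegular (N' ⧸ LinearMap.range g.hom) xs → Function.Injective g.hom →
      IsExtNull g n → (∀ i, Module.length R (Ext N' (residueModule R) i) = n.choose i) →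
      (∃ c, HasProjectiveDimensionLE N' c) →
      ∃ (B : ModuleCat.{u} R)
        (h : ModuleCat.of R (N ⧸ Ideal.ofList xs • (⊤ : Submodule R N)) ⟶ B),
        Module.Finite R B ∧ Function.Injective h.hom ∧ IsExtNull h (n + xs.length) ∧
        (∀ i, Module.length R (Ext B (residueModule R) i) = (n + xs.length).choose i) ∧
        (∃ c, HasProjectiveDimensionLE B c) ∧
        (∀ x ∈ xs, x ^ 2 ∈ Module.annihilator R B) ∧
        Module.annihilator R N' ≤ Module.annihilator R B := by
  induction xs with
  | nil =>
    intro N N' g n hfin _ _ _ hg hnull hlen hpd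
    let e : (N ⧸ Ideal.ofList ([] : List R) • (⊤ : Submodule R N)) ≃ₗ[R] N :=
      Submodule.quotEquivOfEqBot _ (by simp)
    refine ⟨N', ModuleCat.ofHom e.toLinearMap ≫ g, hfin, ?_, hnull.precomp _, hlen, hpd,
      by simp, le_rfl⟩
    simpa using hg
  | cons x xs ih =>
    intro N N' g n hfin hN hN' hC hg hnull hlen ⟨c, hc⟩
    rw [isWeaklyRegular_cons_iff] at hN hN' hC
    have hx : x ∈ maximalIdeal R := hxs x List.mem_cons_self
    have hx2 : x ^ 2 ∈ maximalIdeal R := Ideal.pow_mem_of_mem _ hx 2 two_pos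
    have hreg2 : IsSMulRegular N' (x ^ 2) := hN'.1.pow 2
    have hpd' : HasProjectiveDimensionLE (ModuleCat.of R (QuotSMulTop (x ^ 2) N')) (c + 1) :=
      (hreg2.smulShortComplex_shortExact (M := N')).hasProjectiveDimensionLT_X₃ (c + 1) hc
        (hasProjectiveDimensionLT_of_ge N' (c + 1) (c + 2) (by omega))
    obtain ⟨B, h, hB, hinj, hnullB, hlenB, hpdB, hsq, hann⟩ :=
      ih (fun y hy => hxs y (List.mem_cons_of_mem _ hy))
        (ModuleCat.ofHom (_root_.squareStep g.hom x)) (n + 1)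
        (inferInstanceAs (Module.Finite R (QuotSMulTop (x ^ 2) N')))
        hN.2 (isWeaklyRegular_quotSMulTop_sq hN'.1 hN'.2)
        (isWeaklyRegular_coker_squareStep hN'.1 hN'.2 hC.2)
        (squareStep_injective hg hN'.1 hC.1) (hnull.squareStep hx hN.1 hN'.1)
        (length_ext_quotSMulTop hx2 hreg2 hlen) ⟨_, hpd'⟩
    have hcount : n + (x :: xs).length = n + 1 + xs.length := by
      rw [List.length_cons]; omega
    let e := Submodule.quotOfListConsSMulTopEquivQuotSMulTopInner N x xs
    refine ⟨B, ModuleCat.ofHom e.toLinearMap ≫ h, hB, ?_, ?_, ?_, hpdB, ?_, ?_⟩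
    · simpa using hinj
    · rw [hcount]; exact hnullB.precomp _
    · rw [hcount]; exact hlenB
    · intro y hy
      rcases List.mem_cons.1 hy with rfl | hy
      · exact hann (QuotSMulTop.mem_annihilator N' (y ^ 2))
      · exact hsq y hy
    · refine le_trans (fun r hr => ?_) hann
      refine Module.mem_annihilator.2 fun q => ?_
      obtain ⟨m, rfl⟩ := Submodule.Quotient.mk_surjective _ q
      rw [← Submodule.Quotient.mk_smul, Module.mem_annihilator.1 hr m, Submodule.Quotient.mk_zero]

end ResidueField

end ModuleCat

/-! ### Betti numbers -/

section Betti

open ModuleCat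

variable {R : Type u} [CommRing R] [IsLocalRing R]

lemma length_residueField : Module.length R (ResidueField R) = 1 := by
  have : IsSimpleModule R (ResidueField R) :=
    isSimpleModule_iff_isCoatom.2 (Ideal.isMaximal_def.1 inferInstance)
  exact Module.length_eq_one R (ResidueField R)

lemma length_ext_zero_free (n : ℕ) :
    Module.length R (Ext (ModuleCat.of R (Fin n → R)) (residueModule R) 0) = n := by
  have e : Ext (ModuleCat.of R (Fin n → R)) (residueModule R) 0 ≃ₗ[R] (Fin n → ResidueField R) :=
    (Ext.linearEquiv₀.trans ModuleCat.homLinearEquiv).trans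
      ((Pi.basisFun R (Fin n)).constr R).symm
  rw [e.length_eq, Module.length_pi, length_residueField]
  simp

omit [IsLocalRing R] in
lemma shortExact_minimalCover (M : ModuleCat.{u} R) [Module.Finite R M] :
    (minimalCover M).shortComplexKer.ShortExact :=
  LinearMap.shortExact_shortComplexKer (minimalCover_surjective M)

/-- Minimality of the cover: the inclusion of the syzygy into the free module induces zero on
`Ext (-) k`. -/
lemma minimalCover_ker_comp_ext_eq_zero (M : ModuleCat.{u} R) [Module.Finite R M] (i : ℕ)
    (e : Ext (minimalCover M).shortComplexKer.X₂ (residueModule R) i) :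
    (Ext.mk₀ (minimalCover M).shortComplexKer.f).comp e (zero_add i) = 0 := by
  cases i with
  | zero =>
    obtain ⟨φ, rfl⟩ := (Ext.mk₀_bijective _ _).2 e
    rw [Ext.mk₀_comp_mk₀]
    have : (minimalCover M).shortComplexKer.f ≫ φ = 0 := by
      refine ModuleCat.hom_ext (LinearMap.ext fun a => ?_)
      change φ.hom (a : Fin (minGenNumber M) → R) = 0
      rw [LinearMap.pi_apply_eq_sum_univ φ.hom]
      refine Finset.sum_eq_zero fun i _ => ?_
      exact Module.mem_annihilator.1 (mem_annihilator_residueModule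
        (minimalCover_minimal M a.1 a.2 i)) _
    rw [this, Ext.mk₀_zero]
  | succ i =>
    have : Projective (minimalCover M).shortComplexKer.X₂ :=
      ModuleCat.projective_of_free (Pi.basisFun R (Fin (minGenNumber M)))
    rw [e.eq_zero_of_projective, Ext.comp_zero]

lemma length_ext_zero_eq_minGenNumber (M : ModuleCat.{u} R) [Module.Finite R M] :
    Module.length R (Ext M (residueModule R) 0) = minGenNumber M :=
  (length_ext_zero_of_comp_eq_zero (shortExact_minimalCover M) _
    (minimalCover_ker_comp_ext_eq_zero M 0)).trans (length_ext_zero_free _)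

lemma length_ext_succ_eq_length_ext_syzygy (M : ModuleCat.{u} R) [Module.Finite R M] (i : ℕ) :
    Module.length R (Ext M (residueModule R) (i + 1)) =
      Module.length R (Ext (syzygy M 1) (residueModule R) i) := by
  have h := length_ext_succ_of_comp_eq_zero (shortExact_minimalCover M) (residueModule R) i
    (minimalCover_ker_comp_ext_eq_zero M i) (minimalCover_ker_comp_ext_eq_zero M (i + 1))
  have : Projective (minimalCover M).shortComplexKer.X₂ :=
    ModuleCat.projective_of_free (Pi.basisFun R (Fin (minGenNumber M)))
  have h0 : Module.length R
      (Ext (minimalCover M).shortComplexKer.X₂ (residueModule R) (i + 1)) = 0 :=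
    Module.length_eq_zero_iff.2 (Ext.subsingleton_of_projective _ _ i)
  rw [h0, add_zero] at h
  exact h

variable [IsNoetherianRing R]

instance finite_syzygy (M : ModuleCat.{u} R) [Module.Finite R M] (n : ℕ) :
    Module.Finite R (syzygy M n) := by
  cases n with
  | zero => assumption
  | succ n =>
    change Module.Finite R (LinearMap.ker (minimalCover (syzygy M n)))
    infer_instance

/-- The number of generators of the `i`-th syzygy, the `i`-th Betti number, is the length of
`Ext i M k`. -/
lemma length_ext_eq_minGenNumber_syzygy (M : ModuleCat.{u} R) [Module.Finite R M] (i : ℕ) :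
    Module.length R (Ext M (residueModule R) i) = minGenNumber (syzygy M i) := by
  suffices h : ∀ j i, Module.length R (Ext M (residueModule R) (i + j)) =
      Module.length R (Ext (syzygy M j) (residueModule R) i) by
    have := h i 0
    rw [zero_add] at this
    rw [this, length_ext_zero_eq_minGenNumber]
  intro j
  induction j with
  | zero => intro i; rfl
  | succ j ih =>
    intro i
    rw [← add_assoc, add_right_comm, ih (i + 1), length_ext_succ_eq_length_ext_syzygy]
    rfl

end Betti

/-! ### Ranks of syzygies -/

section Rank

open TensorProduct

/-- Over a semilocal ring, the kernel of a surjection between finite free modules is free, being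
projective of constant rank. -/
lemma exists_add_eq_and_nonempty_basis_of_exact {Q : Type*} [CommRing Q] [Nontrivial Q]
    [Finite (MaximalSpectrum Q)] {K A B : Type*} [AddCommGroup K] [Module Q K] [AddCommGroup A]
    [Module Q A] [AddCommGroup B] [Module Q B] {n r : ℕ} (bA : Module.Basis (Fin n) Q A)
    (bB : Module.Basis (Fin r) Q B) (f : K →ₗ[Q] A) (g : A →ₗ[Q] B) (hf : Function.Injective f)
    (hfg : Function.Exact f g) (hg : Function.Surjective g) :
    ∃ s, s + r = n ∧ Nonempty (Module.Basis (Fin s) Q K) := by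
  have : Module.Free Q A := .of_basis bA
  have : Module.Finite Q A := .of_basis bA
  have : Module.Free Q B := .of_basis bB
  have : Module.Finite Q B := .of_basis bB
  obtain ⟨l, hl⟩ : ∃ l : B →ₗ[Q] A, g ∘ₗ l = LinearMap.id :=
    Module.projective_lifting_property g LinearMap.id hg
  let e : A ≃ₗ[Q] K × B := (hfg.splitSurjectiveEquiv hf ⟨l, hl⟩).1
  have hKfin : Module.Finite Q K :=
    Module.Finite.of_surjective (LinearMap.fst Q K B ∘ₗ e.toLinearMap)
      ((LinearMap.fst_surjective (R := Q)).comp e.surjective)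
  have hproj : Module.Projective Q K :=
    Module.Projective.of_split (e.symm.toLinearMap ∘ₗ LinearMap.inl Q K B)
      (LinearMap.fst Q K B ∘ₗ e.toLinearMap) (by ext; simp)
  have hrank : ∀ P : MaximalSpectrum Q,
      Module.finrank (Q ⧸ P.1) ((Q ⧸ P.1) ⊗[Q] K) + r = n := by
    intro P
    let := Ideal.Quotient.field P.1
    have e' := (LinearEquiv.baseChange Q (Q ⧸ P.1) A (K × B) e).trans
      (TensorProduct.prodRight Q (Q ⧸ P.1) (Q ⧸ P.1) K B)
    have h := e'.finrank_eq
    rw [Module.finrank_prod, Module.finrank_baseChange (R := Q ⧸ P.1) (M' := A),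
      Module.finrank_baseChange (R := Q ⧸ P.1) (M' := B), Module.finrank_eq_card_basis bA,
      Module.finrank_eq_card_basis bB, Fintype.card_fin, Fintype.card_fin] at h
    exact h.symm
  obtain ⟨P⟩ : Nonempty (MaximalSpectrum Q) := inferInstance
  refine ⟨n - r, ?_, ?_⟩
  · have := hrank P; omega
  · exact Module.nonempty_basis_of_flat_of_finrank_eq Q K (n - r) fun P => by
      have := hrank P; omega

variable {R : Type u} [CommRing R]

/-- A syzygy of a module with a rank has a rank: the total ring of fractions of a Noetherian ring
is semilocal. -/
lemma HasModuleRank.exists_of_exact [Nontrivial R] [IsNoetherianRing R] {K M : Type*}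
    [AddCommGroup K] [Module R K] [AddCommGroup M] [Module R M] {n r : ℕ}
    (f : K →ₗ[R] (Fin n → R)) (g : (Fin n → R) →ₗ[R] M) (hf : Function.Injective f)
    (hfg : Function.Exact f g) (hg : Function.Surjective g) (hM : HasModuleRank R M r) :
    ∃ s, s + r = n ∧ HasModuleRank R K s := by
  obtain ⟨e⟩ := hM
  let S := nonZeroDivisors R
  have : IsNoetherianRing (Localization S) := IsLocalization.isNoetherianRing S _ inferInstance
  have : Nontrivial (Localization S) := inferInstanceAs (Nontrivial (FractionRing R))
  have : IsFractionRing (Localization S) (Localization S) := IsFractionRing.idem R _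
  have bA : Module.Basis (Fin n) (Localization S) (LocalizedModule S (Fin n → R)) :=
    (Pi.basisFun R (Fin n)).ofIsLocalizedModule (Localization S) S
      (LocalizedModule.mkLinearMap S (Fin n → R))
  have bB : Module.Basis (Fin r) (Localization S) (LocalizedModule S M) := .ofEquivFun e
  obtain ⟨s, hs, ⟨b⟩⟩ := exists_add_eq_and_nonempty_basis_of_exact bA bB
    (LocalizedModule.map S f) (LocalizedModule.map S g) (LocalizedModule.map_injective S f hf)
    (LocalizedModule.map_exact S f g hfg) (LocalizedModule.map_surjective S g hg)
  exact ⟨s, hs, ⟨b.equivFun⟩⟩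

lemma hasModuleRank_zero_of_smul_eq_zero {M : Type*} [AddCommGroup M] [Module R M] {x : R}
    (hx : x ∈ nonZeroDivisors R) (h : ∀ m : M, x • m = 0) : HasModuleRank R M 0 := by
  have : Subsingleton (LocalizedModule (nonZeroDivisors R) M) := by
    rw [LocalizedModule.subsingleton_iff]
    exact fun m => ⟨x, hx, h m⟩
  exact ⟨LinearEquiv.ofSubsingleton _ _⟩

/-- If a module is killed by a nonzerodivisor, then its syzygies have ranks, which are the
alternating sums of its Betti numbers. -/
lemma exists_hasModuleRank_syzygy [IsLocalRing R] [IsNoetherianRing R] (M : ModuleCat.{u} R)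
    [Module.Finite R M] {x : R} (hx : x ∈ nonZeroDivisors R) (h : ∀ m : M, x • m = 0) :
    ∃ ρ : ℕ → ℕ, ρ 0 = 0 ∧ (∀ i, ρ (i + 1) + ρ i = minGenNumber (syzygy M i)) ∧
      ∀ i, HasModuleRank R (syzygy M i) (ρ i) := by
  have hex : ∀ i, ∃ r, HasModuleRank R (syzygy M i) r := by
    intro i
    induction i with
    | zero => exact ⟨0, hasModuleRank_zero_of_smul_eq_zero (M := M) hx h⟩
    | succ i ih =>
      obtain ⟨r, hr⟩ := ih
      obtain ⟨s, -, hs⟩ := HasModuleRank.exists_of_exact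
        (LinearMap.ker (minimalCover (syzygy M i))).subtype (minimalCover (syzygy M i))
        (Submodule.subtype_injective _) (LinearMap.exact_subtype_ker_map _)
        (minimalCover_surjective _) hr
      exact ⟨s, hs⟩
  choose ρ hρ using hex
  refine ⟨ρ, ?_, fun i => ?_, hρ⟩
  · exact (hρ 0).unique (hasModuleRank_zero_of_smul_eq_zero (M := M) hx h)
  · obtain ⟨s, hsum, hs⟩ := HasModuleRank.exists_of_exact
      (LinearMap.ker (minimalCover (syzygy M i))).subtype (minimalCover (syzygy M i))
      (Submodule.subtype_injective _) (LinearMap.exact_subtype_ker_map _)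
      (minimalCover_surjective _) (hρ i)
    rw [(hρ (i + 1)).unique hs, hsum]

end Rank

/-! ### Serre's homological criterion for regularity -/

section Regular

/-- Change of rings: a finite projective dimension survives reduction modulo an element that is
regular on the ring and on the module. -/
lemma hasProjectiveDimensionLE_quotSMulTop {R : Type u} [CommRing R] {x : R}
    (hx : IsSMulRegular R x) (c : ℕ) :
    ∀ N : ModuleCat.{u} R, IsSMulRegular N x → HasProjectiveDimensionLE N c →
      HasProjectiveDimensionLE (ModuleCat.of (R ⧸ Ideal.span {x}) (QuotSMulTop x N)) c := by
  have hproj : ∀ N : ModuleCat.{u} R, Module.Projective R N →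
      Projective (ModuleCat.of (R ⧸ Ideal.span {x}) (QuotSMulTop x N)) := by
    intro N hN
    have : Module.Projective (R ⧸ Ideal.span {x}) (QuotSMulTop x N) :=
      Module.Projective.of_equiv ((QuotSMulTop.equivQuotTensor x N).extendScalarsOfSurjective
        Ideal.Quotient.mk_surjective).symm
    exact (IsProjective.iff_projective _).1 this
  induction c with
  | zero =>
    intro N _ hN
    have : Projective N := (projective_iff_hasProjectiveDimensionLE_zero _).2 hN
    exact (projective_iff_hasProjectiveDimensionLE_zero _).1
      (hproj N ((IsProjective.iff_projective (R := R) N).2 this))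
  | succ c ih =>
    intro N hreg hN
    let e : Module.Basis N R (N →₀ R) := ⟨LinearEquiv.refl R _⟩
    let g : (N →₀ R) →ₗ[R] N := e.constr ℕ id
    have hg : Function.Surjective g := fun n => ⟨Finsupp.single n 1, by
      simp [g, e, Module.Basis.constr_apply]⟩
    let K := LinearMap.ker g
    have hS := LinearMap.shortExact_shortComplexKer hg
    have hF : Projective (ModuleCat.of R (N →₀ R)) :=
      ModuleCat.projective_of_free e
    have hK : HasProjectiveDimensionLE (ModuleCat.of R K) c :=
      (hS.hasProjectiveDimensionLT_X₃_iff c hF).1 hN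
    have hKreg : IsSMulRegular K x := by
      refine IsSMulRegular.submodule K x (fun a b hab => ?_)
      ext n
      exact hx (by simpa using DFunLike.congr_fun hab n)
    have ihK := ih (ModuleCat.of R K) hKreg hK
    let i' := (QuotSMulTop.map (M := K) (M' := N →₀ R) x K.subtype).extendScalarsOfSurjective
      (Ideal.Quotient.mk_surjective (I := Ideal.span {x}))
    let g' := (QuotSMulTop.map x g).extendScalarsOfSurjective
      (Ideal.Quotient.mk_surjective (I := Ideal.span {x}))
    have hex : Function.Exact i' g' :=
      QuotSMulTop.map_exact x (LinearMap.exact_subtype_ker_map g) hg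
    have hsurj : Function.Surjective g' := QuotSMulTop.map_surjective x hg
    have hinj : Function.Injective i' := by
      have h0 : Function.Exact (0 : K →ₗ[R] K) K.subtype := by
        rw [LinearMap.exact_iff, Submodule.ker_subtype, LinearMap.range_zero]
      have h := QuotSMulTop.map_first_exact_on_four_term_exact_of_isSMulRegular_last
        (M := K) (M' := K) (M'' := N →₀ R) h0 (LinearMap.exact_subtype_ker_map g) hreg
      rw [map_zero, LinearMap.exact_iff, LinearMap.range_zero] at h
      have h' : Function.Injective (QuotSMulTop.map (M := K) (M' := N →₀ R) x K.subtype) :=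
        LinearMap.ker_eq_bot.1 h
      exact h'
    let S' : ShortComplex (ModuleCat.{u} (R ⧸ Ideal.span {x})) :=
      ModuleCat.shortComplexOfCompEqZero i' g' hex.linearMap_comp_eq_zero
    have hS' : S'.ShortExact := ModuleCat.shortComplex_shortExact S' hex hinj hsurj
    have hP : Projective S'.X₂ := hproj (ModuleCat.of R (N →₀ R))
      ((IsProjective.iff_projective (R := R) _).2 hF)
    exact (hS'.hasProjectiveDimensionLT_X₃_iff c hP).2 ihK

/-- If the maximal ideal has a nonzero annihilator `s`, then every finitely generated module of
finite projective dimension is free, because `s` kills the syzygies. -/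
lemma free_of_hasProjectiveDimensionLE {R : Type u} [CommRing R] [IsLocalRing R]
    [IsNoetherianRing R] {s : R} (hs0 : s ≠ 0) (hs : ∀ a ∈ maximalIdeal R, s * a = 0) (c : ℕ) :
    ∀ (N : ModuleCat.{u} R), Module.Finite R N → HasProjectiveDimensionLE N c →
      Module.Free R N := by
  induction c with
  | zero =>
    intro N _ hN
    have : Projective N := (projective_iff_hasProjectiveDimensionLE_zero _).2 hN
    have : Module.Projective R N := (IsProjective.iff_projective (R := R) N).2 this
    exact Module.free_of_flat_of_isLocalRing
  | succ c ih =>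
    intro N _ hN
    have hF : Projective (minimalCover N).shortComplexKer.X₂ :=
      ModuleCat.projective_of_free (Pi.basisFun R (Fin (minGenNumber N)))
    have hK := ih (ModuleCat.of R (LinearMap.ker (minimalCover N))) inferInstance
      (((shortExact_minimalCover N).hasProjectiveDimensionLT_X₃_iff c hF).1 hN)
    have hfree : Module.Free R (LinearMap.ker (minimalCover N)) := hK
    have hker : LinearMap.ker (minimalCover N) = ⊥ := by
      by_contra hne
      have : Nontrivial (LinearMap.ker (minimalCover N)) := Submodule.nontrivial_iff_ne_bot.2 hne
      have hann : s ∈ Module.annihilator R (LinearMap.ker (minimalCover N)) := by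
        refine Module.mem_annihilator.2 fun a => Subtype.ext (funext fun i => ?_)
        exact hs _ (minimalCover_minimal N a.1 a.2 i)
      rw [Module.annihilator_eq_bot.2 inferInstance, Submodule.mem_bot] at hann
      exact hs0 hann
    exact Module.Free.of_equiv (LinearEquiv.ofBijective (minimalCover N)
      ⟨LinearMap.ker_eq_bot.1 hker, minimalCover_surjective N⟩)

section Retract

variable {R : Type u} [CommRing R] [IsLocalRing R]

/-- A minimal generator of the maximal ideal can be sent to `1` by a map to the residue field. -/
lemma exists_cotangent_functional {x : R} (hx : x ∈ maximalIdeal R) (hx2 : x ∉ maximalIdeal R ^ 2) :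
    ∃ φ : maximalIdeal R →ₗ[R] ResidueField R, φ ⟨x, hx⟩ = 1 := by
  have hne : (maximalIdeal R).toCotangent ⟨x, hx⟩ ≠ 0 := by
    rwa [Ne, Ideal.toCotangent_eq_zero]
  obtain ⟨f, hf⟩ : ∃ f : Module.Dual (ResidueField R) (CotangentSpace R),
      f ((maximalIdeal R).toCotangent ⟨x, hx⟩) ≠ 0 := by
    by_contra! h
    exact hne ((Module.forall_dual_apply_eq_zero_iff (ResidueField R) _).1 h)
  refine ⟨((f ((maximalIdeal R).toCotangent ⟨x, hx⟩))⁻¹ • f).restrictScalars R ∘ₗ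
    (maximalIdeal R).toCotangent, ?_⟩
  simp [hf]

/-- For `x ∈ 𝔪 \ 𝔪 ^ 2`, the maximal ideal of `R / (x)` is a direct summand of `𝔪 / x 𝔪`: the
complement is the copy of the residue field spanned by the class of `x`. -/
lemma exists_retract_maximalIdeal_quotient {x : R} (hx : x ∈ maximalIdeal R)
    (hx2 : x ∉ maximalIdeal R ^ 2) [IsLocalRing (R ⧸ Ideal.span {x})] :
    Nonempty (Retract
      (ModuleCat.of (R ⧸ Ideal.span {x}) (maximalIdeal (R ⧸ Ideal.span {x})))
      (ModuleCat.of (R ⧸ Ideal.span {x}) (QuotSMulTop x (maximalIdeal R)))) := by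
  obtain ⟨φ, hφ⟩ := exists_cotangent_functional hx hx2
  have hloc : IsLocalHom (Ideal.Quotient.mk (Ideal.span {x})) :=
    IsLocalHom.of_surjective _ Ideal.Quotient.mk_surjective
  have hmem : ∀ y : R, Ideal.Quotient.mk (Ideal.span {x}) y ∈ maximalIdeal (R ⧸ Ideal.span {x}) ↔
      y ∈ maximalIdeal R := by
    intro y
    simp only [mem_maximalIdeal, mem_nonunits_iff, isUnit_map_iff]
  let q₀ : maximalIdeal R →ₗ[R] maximalIdeal (R ⧸ Ideal.span {x}) :=
    { toFun := fun y => ⟨Ideal.Quotient.mk _ y.1, (hmem _).2 y.2⟩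
      map_add' := fun _ _ => rfl
      map_smul' := fun _ _ => rfl }
  have hq₀ : Function.Surjective q₀ := by
    rintro ⟨y, hy⟩
    obtain ⟨y, rfl⟩ := Ideal.Quotient.mk_surjective y
    exact ⟨⟨y, (hmem y).1 hy⟩, rfl⟩
  have hq₀x : q₀ ⟨x, hx⟩ = 0 :=
    Subtype.ext (Ideal.Quotient.eq_zero_iff_mem.2 (Ideal.mem_span_singleton_self x))
  let q : QuotSMulTop x (maximalIdeal R) →ₗ[R] maximalIdeal (R ⧸ Ideal.span {x}) :=
    Submodule.liftQ _ q₀ (by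
      rintro _ hn
      obtain ⟨n, -, rfl⟩ := (Submodule.mem_smul_pointwise_iff_exists _ _ _).1 hn
      refine Subtype.ext (Ideal.Quotient.eq_zero_iff_mem.2 (Ideal.mem_span_singleton.2 ?_))
      exact ⟨n.1, rfl⟩)
  let X : QuotSMulTop x (maximalIdeal R) := Submodule.Quotient.mk ⟨x, hx⟩
  -- the map `k → 𝔪 / x 𝔪` sending `1` to the class of `x`
  let ι : ResidueField R →ₗ[R] QuotSMulTop x (maximalIdeal R) :=
    Submodule.liftQ (maximalIdeal R) (LinearMap.toSpanSingleton R _ X) (by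
      intro r hr
      rw [LinearMap.mem_ker, LinearMap.toSpanSingleton_apply, ← Submodule.Quotient.mk_smul,
        quotSMulTop_mk_eq_zero_iff]
      exact ⟨⟨r, hr⟩, Subtype.ext (mul_comm x r)⟩)
  have hι : ∀ r : R, ι (residue R r) = r • X := fun r => rfl
  let ψ : maximalIdeal R →ₗ[R] QuotSMulTop x (maximalIdeal R) := Submodule.mkQ _ - ι ∘ₗ φ
  have hψ : ∀ y, ψ y = Submodule.Quotient.mk y - ι (φ y) := fun _ => rfl
  have hker : LinearMap.ker q₀ ≤ LinearMap.ker ψ := by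
    intro y hy
    have hy' : y.1 ∈ Ideal.span {x} := Ideal.Quotient.eq_zero_iff_mem.1 (congrArg Subtype.val hy)
    obtain ⟨r, hr⟩ := Ideal.mem_span_singleton'.1 hy'
    obtain rfl : y = r • (⟨x, hx⟩ : maximalIdeal R) := Subtype.ext hr.symm
    have h1 : φ (r • (⟨x, hx⟩ : maximalIdeal R)) = residue R r := by
      rw [map_smul, hφ, Algebra.smul_def, mul_one]
      rfl
    rw [LinearMap.mem_ker, hψ, h1, hι, Submodule.Quotient.mk_smul, sub_self]
  let s : maximalIdeal (R ⧸ Ideal.span {x}) →ₗ[R] QuotSMulTop x (maximalIdeal R) :=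
    (LinearMap.ker q₀).liftQ ψ hker ∘ₗ (q₀.quotKerEquivOfSurjective hq₀).symm.toLinearMap
  have hs : ∀ y, s (q₀ y) = ψ y := by
    intro y
    have : (q₀.quotKerEquivOfSurjective hq₀).symm (q₀ y) = Submodule.Quotient.mk y := by
      rw [LinearEquiv.symm_apply_eq]
      rfl
    change (LinearMap.ker q₀).liftQ ψ hker ((q₀.quotKerEquivOfSurjective hq₀).symm (q₀ y)) = _
    rw [this]
    rfl
  have hqs : ∀ z, q (s z) = z := by
    intro z
    obtain ⟨y, rfl⟩ := hq₀ z
    rw [hs, hψ, map_sub]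
    obtain ⟨r, hr⟩ := residue_surjective (φ y)
    rw [← hr, hι, map_smul]
    change q₀ y - r • q₀ ⟨x, hx⟩ = q₀ y
    rw [hq₀x, smul_zero, sub_zero]
  exact ⟨{
    i := ModuleCat.ofHom (s.extendScalarsOfSurjective Ideal.Quotient.mk_surjective)
    r := ModuleCat.ofHom (q.extendScalarsOfSurjective Ideal.Quotient.mk_surjective)
    retract := by
      ext z
      exact congrArg Subtype.val (hqs z) }⟩

end Retract

variable {R : Type u} [CommRing R] [IsLocalRing R] [IsNoetherianRing R]

/-- The maximal ideal of `R` has at most one generator more than that of `R / (x)`. -/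
lemma spanFinrank_maximalIdeal_le_of_quotient (x : R)
    [IsLocalRing (R ⧸ Ideal.span {x})] :
    (maximalIdeal R).spanFinrank ≤ (maximalIdeal (R ⧸ Ideal.span {x})).spanFinrank + 1 := by
  classical
  set π := Ideal.Quotient.mk (Ideal.span {x})
  have hπ : Function.Surjective π := Ideal.Quotient.mk_surjective
  have hloc : IsLocalHom π := IsLocalHom.of_surjective _ hπ
  obtain ⟨T, hT, hspan⟩ := (IsNoetherian.noetherian
    (maximalIdeal (R ⧸ Ideal.span {x}))).exists_span_finset_card_eq_spanFinrank
  let σ := Function.surjInv hπ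
  have hσ : ∀ y, π (σ y) = y := Function.surjInv_eq hπ
  have key : maximalIdeal R = Ideal.span ((insert x (T.image σ) : Finset R) : Set R) := by
    have h1 : Ideal.map π (Ideal.span (T.image σ : Finset R)) =
        maximalIdeal (R ⧸ Ideal.span {x}) := by
      rw [Ideal.map_span, ← hspan]
      congr 1
      ext y
      simp only [Finset.coe_image, Set.mem_image, Finset.mem_coe, exists_exists_and_eq_and, hσ,
        exists_eq_right]
    have h2 : Ideal.comap π (maximalIdeal (R ⧸ Ideal.span {x})) = maximalIdeal R := by
      ext y
      simp only [Ideal.mem_comap, mem_maximalIdeal, mem_nonunits_iff, isUnit_map_iff]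
    rw [← h2, ← h1, Ideal.comap_map_of_surjective π hπ, ← RingHom.ker_eq_comap_bot,
      Ideal.mk_ker, sup_comm, Finset.coe_insert, ← Ideal.span_union, Set.singleton_union]
  rw [key]
  refine (Submodule.spanFinrank_span_le_ncard_of_finite (Finset.finite_toSet _)).trans ?_
  rw [Set.ncard_coe_finset, ← hT]
  exact (Finset.card_insert_le _ _).trans (Nat.add_le_add_right Finset.card_image_le 1)

/-- Either the maximal ideal has a nonzero annihilator, or it contains a regular element outside
its square. -/
lemma exists_annihilator_or_exists_regular :
    (∃ s : R, s ≠ 0 ∧ ∀ a ∈ maximalIdeal R, s * a = 0) ∨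
      ∃ x ∈ maximalIdeal R, x ∉ maximalIdeal R ^ 2 ∧ IsSMulRegular R x := by
  by_contra! h
  obtain ⟨hA, hB⟩ := h
  -- otherwise prime avoidance puts `𝔪` inside `𝔪 ^ 2` or inside an associated prime of `R`
  have hcov : ((maximalIdeal R : Ideal R) : Set R) ⊆
      ⋃ I ∈ insert (maximalIdeal R ^ 2) (associatedPrimes R R), (I : Set R) := by
    intro y hy
    rw [Set.biUnion_insert, biUnion_associatedPrimes_eq_compl_regular R]
    by_cases hy2 : y ∈ maximalIdeal R ^ 2
    · exact Or.inl hy2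
    · exact Or.inr (hB y hy hy2)
  obtain ⟨I, hI, hle⟩ := (Ideal.subset_union_prime_finite
    ((associatedPrimes.finite R R).insert (maximalIdeal R ^ 2)) (f := id)
    (maximalIdeal R ^ 2) (maximalIdeal R ^ 2) (by
      intro I hI hne _
      rcases hI with rfl | hI
      · exact absurd rfl hne
      · exact hI.isPrime)).1 hcov
  rcases hI with rfl | hI
  · have hbot : maximalIdeal R = ⊥ := by
      refine Submodule.eq_bot_of_le_smul_of_le_jacobson_bot (maximalIdeal R) _
        (IsNoetherian.noetherian _) ?_ (maximalIdeal_le_jacobson _)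
      rw [smul_eq_mul, ← pow_two]
      exact hle
    obtain ⟨a, ha, hne⟩ := hA 1 one_ne_zero
    rw [hbot, Ideal.mem_bot] at ha
    exact hne (by rw [ha, mul_zero])
  · have hP := hI.isPrime
    obtain rfl : I = maximalIdeal R := le_antisymm (le_maximalIdeal hP.ne_top) hle
    rw [AssociatedPrimes.mem_iff, isAssociatedPrime_iff] at hI
    obtain ⟨-, s, hs⟩ := hI
    have hs0 : s ≠ 0 := by
      rintro rfl
      have : (1 : R) ∈ maximalIdeal R := by rw [hs]; simp [Submodule.mem_colon]
      exact (Ideal.ne_top_iff_one _).1 hP.ne_top this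
    obtain ⟨a, ha, hne⟩ := hA s hs0
    rw [hs] at ha
    exact hne (by simpa [mul_comm] using ha)

/-- Serre: a local ring whose maximal ideal has finite projective dimension is regular. The
induction on the dimension divides by a regular element outside `𝔪 ^ 2`. -/
lemma isRegularLocalRing_of_hasProjectiveDimensionLE_maximalIdeal (n : ℕ) :
    ∀ (R : Type u) [CommRing R] [IsLocalRing R] [IsNoetherianRing R] (c : ℕ),
      ringKrullDim R = n → HasProjectiveDimensionLE (ModuleCat.of R (maximalIdeal R)) c →
      IsRegularLocalRing R := by
  induction n using Nat.strong_induction_on with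
  | _ n ih =>
    intro R _ _ _ c hdim hpd
    rcases exists_annihilator_or_exists_regular (R := R) with ⟨s, hs0, hs⟩ | ⟨x, hx, hx2, hreg⟩
    · have hfree : Module.Free R (maximalIdeal R) :=
        free_of_hasProjectiveDimensionLE hs0 hs c _ inferInstance hpd
      have hbot : maximalIdeal R = ⊥ := by
        by_contra hne
        have : Nontrivial (maximalIdeal R) := Submodule.nontrivial_iff_ne_bot.2 hne
        have hann : s ∈ Module.annihilator R (maximalIdeal R) :=
          Module.mem_annihilator.2 fun a => Subtype.ext (hs a.1 a.2)
        rw [Module.annihilator_eq_bot.2 inferInstance, Submodule.mem_bot] at hann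
        exact hs0 hann
      refine IsRegularLocalRing.of_spanFinrank_maximalIdeal_le R ?_
      rw [hbot, Submodule.spanFinrank_bot, hdim]
      exact_mod_cast Nat.zero_le n
    · have hnt : Nontrivial (R ⧸ Ideal.span {x}) := Ideal.Quotient.nontrivial_iff.2 (by
        rw [Ne, Ideal.span_singleton_eq_top]
        exact hx)
      have hloc : IsLocalRing (R ⧸ Ideal.span {x}) :=
        IsLocalRing.of_surjective' (Ideal.Quotient.mk _) Ideal.Quotient.mk_surjective
      have hd := ringKrullDim_quotient_span_singleton_succ_eq_ringKrullDim hreg hx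
      obtain ⟨n', hn'⟩ := exists_ringKrullDim_eq_natCast (R ⧸ Ideal.span {x})
      rw [hn', hdim] at hd
      have hnn : n' + 1 = n := by exact_mod_cast hd
      obtain ⟨ret⟩ := exists_retract_maximalIdeal_quotient hx hx2
      have hpdQ := hasProjectiveDimensionLE_quotSMulTop hreg c
        (ModuleCat.of R (maximalIdeal R)) (IsSMulRegular.submodule (maximalIdeal R) x hreg) hpd
      have hpd' := ret.hasProjectiveDimensionLT (c + 1)
      have hR' := ih n' (by omega) (R ⧸ Ideal.span {x}) c hn' hpd'
      refine IsRegularLocalRing.of_spanFinrank_maximalIdeal_le R ?_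
      have h1 := hR'.spanFinrank_maximalIdeal
      rw [hn'] at h1
      have h2 : (maximalIdeal (R ⧸ Ideal.span {x})).spanFinrank = n' := by exact_mod_cast h1
      have h3 := spanFinrank_maximalIdeal_le_of_quotient x
      rw [h2, hnn] at h3
      rw [hdim]
      exact_mod_cast h3

end Regular

/-! ### Finite length, and the cokernel of the residue field -/

section FiniteLength

lemma krullDimLE_zero_quotient {R : Type u} [CommRing R] (I : Ideal R)
    (h : ∀ p : Ideal R, p.IsPrime → I ≤ p → p.IsMaximal) : Ring.KrullDimLE 0 (R ⧸ I) := by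
  rw [Ring.krullDimLE_zero_iff]
  intro q hq
  have hsurj : Function.Surjective (Ideal.Quotient.mk I) := Ideal.Quotient.mk_surjective
  have hmax := h (q.comap (Ideal.Quotient.mk I)) inferInstance fun a ha => by
    rw [Ideal.mem_comap, Ideal.Quotient.eq_zero_iff_mem.2 ha]
    exact q.zero_mem
  have := Ideal.map_eq_top_or_isMaximal_of_surjective _ hsurj hmax
  rw [Ideal.map_comap_of_surjective _ hsurj] at this
  exact this.resolve_left hq.ne_top

lemma isFiniteLength_of_forall_isMaximal {R : Type u} [CommRing R] [IsNoetherianRing R]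
    {M : Type u} [AddCommGroup M] [Module R M] [Module.Finite R M]
    (h : ∀ p : Ideal R, p.IsPrime → Module.annihilator R M ≤ p → p.IsMaximal) :
    IsFiniteLength R M := by
  have := krullDimLE_zero_quotient _ h
  have : IsArtinianRing (R ⧸ Module.annihilator R M) :=
    IsNoetherianRing.isArtinianRing_of_krullDimLE_zero
  have ht : Module.IsTorsionBySet R M (Module.annihilator R M) :=
    Module.isTorsionBySet_annihilator R M
  let := ht.module
  have : IsScalarTower R (R ⧸ Module.annihilator R M) M := ht.isScalarTower
  have : Module.Finite (R ⧸ Module.annihilator R M) M :=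
    Module.Finite.of_restrictScalars_finite R _ M
  rw [isFiniteLength_iff_isNoetherian_isArtinian]
  exact ⟨inferInstance, isArtinian_of_surjective_algebraMap
    (Ideal.Quotient.mk_surjective (I := Module.annihilator R M))⟩

/-- If the residue field has finite projective dimension, so does every module of finite
length. -/
lemma projectiveDimension_ne_top_of_isFiniteLength {R : Type u} [CommRing R] [IsLocalRing R]
    (hk : projectiveDimension (ModuleCat.residueModule R) ≠ ⊤) {M : Type u} [AddCommGroup M]
    [Module R M] (hM : IsFiniteLength R M) :
    projectiveDimension (ModuleCat.of R M) ≠ ⊤ := by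
  obtain ⟨c, hc⟩ := (projectiveDimension_ne_top_iff _).1 hk
  suffices HasProjectiveDimensionLE (ModuleCat.of R M) c from
    (projectiveDimension_ne_top_iff _).2 ⟨c, this⟩
  induction hM with
  | @of_subsingleton M =>
    have := Limits.IsZero.hasProjectiveDimensionLT_zero
      (ModuleCat.isZero_of_subsingleton (ModuleCat.of R M))
    exact hasProjectiveDimensionLT_of_ge _ 0 (c + 1) (Nat.zero_le _)
  | @of_simple_quotient M _ _ N hs _ ih =>
    obtain ⟨I, hI, ⟨e⟩⟩ := isSimpleModule_iff_quot_maximal.1 hs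
    obtain rfl := eq_maximalIdeal hI
    let S : ShortComplex (ModuleCat.{u} R) :=
      ModuleCat.shortComplexOfCompEqZero N.subtype N.mkQ
        (LinearMap.exact_subtype_mkQ N).linearMap_comp_eq_zero
    have hS : S.ShortExact := ModuleCat.shortComplex_shortExact S
      (LinearMap.exact_subtype_mkQ N) N.injective_subtype N.mkQ_surjective
    refine hS.hasProjectiveDimensionLT_X₂ (c + 1) ih ?_
    have e' : ModuleCat.residueModule R ≅ ModuleCat.of R (M ⧸ N) := e.symm.toModuleIso
    exact hasProjectiveDimensionLT_of_iso e' (c + 1)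

end FiniteLength

section Main

variable {R : Type u} [CommRing R]

lemma isWeaklyRegular_of_subsingleton (xs : List R) :
    ∀ (M : Type u) [AddCommGroup M] [Module R M] [Subsingleton M], IsWeaklyRegular M xs := by
  induction xs with
  | nil => intros; exact IsWeaklyRegular.nil R _
  | cons x xs ih =>
    intro M _ _ _
    rw [isWeaklyRegular_cons_iff]
    exact ⟨Function.injective_of_subsingleton _, ih (QuotSMulTop x M)⟩

lemma length_ext_self [IsLocalRing R] (i : ℕ) :
    Module.length R (Ext (ModuleCat.of R R) (ModuleCat.residueModule R) i) =
      Nat.choose 0 i := by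
  cases i with
  | zero =>
    have e : Ext (ModuleCat.of R R) (ModuleCat.residueModule R) 0 ≃ₗ[R] ResidueField R :=
      (Ext.linearEquiv₀.trans ModuleCat.homLinearEquiv).trans (LinearMap.ringLmapEquivSelf R R _)
    rw [e.length_eq, length_residueField]
    simp
  | succ i =>
    rw [Module.length_eq_zero_iff.2 (Ext.subsingleton_of_projective _ _ i)]
    simp

/-- Serre: a local ring over which the residue field has finite projective dimension is
regular. -/
lemma isRegularLocalRing_of_projectiveDimension_residueField_ne_top [IsLocalRing R]
    [IsNoetherianRing R] (h : projectiveDimension (ModuleCat.residueModule R) ≠ ⊤) :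
    IsRegularLocalRing R := by
  obtain ⟨c, hc⟩ := (projectiveDimension_ne_top_iff _).1 h
  obtain ⟨n, hn⟩ := exists_ringKrullDim_eq_natCast R
  let S : ShortComplex (ModuleCat.{u} R) :=
    ModuleCat.shortComplexOfCompEqZero (maximalIdeal R).subtype (maximalIdeal R).mkQ
      (LinearMap.exact_subtype_mkQ _).linearMap_comp_eq_zero
  have hS : S.ShortExact := ModuleCat.shortComplex_shortExact S
    (LinearMap.exact_subtype_mkQ _) (maximalIdeal R).injective_subtype
    (maximalIdeal R).mkQ_surjective
  have hP : Projective S.X₂ := ModuleCat.projective_of_free (Module.Basis.singleton Unit R)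
  refine isRegularLocalRing_of_hasProjectiveDimensionLE_maximalIdeal n R c hn ?_
  have hX₂ : HasProjectiveDimensionLT S.X₂ 1 := projective_iff_hasProjectiveDimensionLT_one.1 hP
  exact hS.hasProjectiveDimensionLT_X₁ (c + 1)
    (hasProjectiveDimensionLT_of_ge S.X₂ 1 (c + 1) (by omega))
    (hasProjectiveDimensionLT_of_ge (ModuleCat.residueModule R) (c + 1) (c + 2) (by omega))

/-- A maximal regular sequence in a Gorenstein local ring generates an ideal contained in no
prime except the maximal ideal, and its length is the dimension. -/
lemma IsGorensteinLocal.exists_isRegular [IsGorensteinLocal R] {d : ℕ}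
    (hdim : ringKrullDim R = d) :
    ∃ xs : List R, xs.length = d ∧ IsRegular R xs ∧ (∀ x ∈ xs, x ∈ maximalIdeal R) ∧
      (∀ p : Ideal R, p.IsPrime → Ideal.ofList xs ≤ p → p = maximalIdeal R) ∧
      ∃ f : ResidueField R →ₗ[R] R ⧸ Ideal.ofList xs • (⊤ : Submodule R R),
        Function.Injective f := by
  obtain ⟨xs, hreg, hmem, f, hf⟩ := exists_isRegular_residueField_embedding R
  have hprime : ∀ p : Ideal R, p.IsPrime → Ideal.ofList xs ≤ p → p = maximalIdeal R :=
    fun p hp hle => eq_maximalIdeal_of_injectiveDimension_ne_top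
      IsGorensteinLocal.injectiveDimension_ne_top hreg hmem f hf p hle
  refine ⟨xs, ?_, hreg, hmem, hprime, f, hf⟩
  have h0 : Ring.KrullDimLE 0 (R ⧸ Ideal.ofList xs) :=
    krullDimLE_zero_quotient _ fun p hp hle => hprime p hp hle ▸ inferInstance
  have : Nontrivial (R ⧸ Ideal.ofList xs) := Ideal.Quotient.nontrivial_iff.2 (by
    simpa using hreg.2.symm)
  have h := ringKrullDim_add_length_eq_ringKrullDim_of_isRegular xs hreg
  rw [ringKrullDimZero_iff_ringKrullDim_eq_zero.1 h0, zero_add, hdim] at h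
  exact_mod_cast h

/-- If the residue field `k` has infinite projective dimension, the cokernel `M` of the embedding
`k → R / (xs) → R / (xs ^ 2)`, for a maximal regular sequence `xs`, satisfies
`rank Ω ^ d M = rank Ω ^ (d - 1) k + 1`. -/
lemma exists_rank_syzygy_eq_add_one [IsGorensteinLocal R] {d : ℕ} (hd : 0 < d)
    (hdim : ringKrullDim R = d) (hk : projectiveDimension (ModuleCat.residueModule R) = ⊤) :
    ∃ M : ModuleCat.{u} R, projectiveDimension M = ⊤ ∧ IsFiniteLength R M ∧
      ∃ r : ℕ, HasModuleRank R (syzygy (ModuleCat.residueModule R) (d - 1)) r ∧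
        HasModuleRank R (syzygy M d) (r + 1) := by
  obtain ⟨xs, hlen, hreg, hmem, hprime, f, hf⟩ := IsGorensteinLocal.exists_isRegular hdim
  have hsub : Subsingleton (R ⧸ LinearMap.range (𝟙 (ModuleCat.of R R) :
      ModuleCat.of R R ⟶ ModuleCat.of R R).hom) := by
    rw [Submodule.Quotient.subsingleton_iff, LinearMap.range_eq_top]
    exact fun a => ⟨a, rfl⟩
  have hproj : Projective (ModuleCat.of R R) :=
    ModuleCat.projective_of_free (Module.Basis.singleton Unit R)
  obtain ⟨B, h, hBfin, hinj, hnull, hβB, ⟨c, hc⟩, hsq, -⟩ :=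
    ModuleCat.exists_isExtNull_of_isWeaklyRegular xs hmem (𝟙 (ModuleCat.of R R)) 0
      (inferInstanceAs (Module.Finite R R)) hreg.1 hreg.1
      (isWeaklyRegular_of_subsingleton xs _) (fun _ _ h => h) (fun i hi => absurd hi (by omega))
      length_ext_self ⟨0, (projective_iff_hasProjectiveDimensionLE_zero _).1 hproj⟩
  rw [zero_add, hlen] at hnull hβB
  -- the embedding `k → R / (xs) → B`, and its cokernel
  let j : ModuleCat.residueModule R ⟶ B := ModuleCat.ofHom f ≫ h
  have hj : Function.Injective j.hom := hinj.comp hf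
  have hjnull : ModuleCat.IsExtNull j d := hnull.precomp _
  let S : ShortComplex (ModuleCat.{u} R) :=
    ModuleCat.shortComplexOfCompEqZero j.hom (LinearMap.range j.hom).mkQ
      j.hom.exact_map_mkQ_range.linearMap_comp_eq_zero
  have hS : S.ShortExact := ModuleCat.shortComplex_shortExact S
    j.hom.exact_map_mkQ_range hj (Submodule.mkQ_surjective _)
  let M := ModuleCat.of R (B ⧸ LinearMap.range j.hom)
  have hMfin : Module.Finite R M := inferInstanceAs (Module.Finite R (B ⧸ LinearMap.range j.hom))
  have hkfin : Module.Finite R (ModuleCat.residueModule R) :=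
    inferInstanceAs (Module.Finite R (ResidueField R))
  refine ⟨M, ?_, ?_, ?_⟩
  · by_contra hM
    obtain ⟨n, hn⟩ := (projectiveDimension_ne_top_iff M).1 hM
    refine (projectiveDimension_ne_top_iff _).2 ⟨c + n, ?_⟩ hk
    exact hS.hasProjectiveDimensionLT_X₁ (c + n + 1)
      (hasProjectiveDimensionLT_of_ge B (c + 1) (c + n + 1) (by omega))
      (hasProjectiveDimensionLT_of_ge M (n + 1) (c + n + 2) (by omega))
  · have hB : IsFiniteLength R B := by
      refine isFiniteLength_of_forall_isMaximal fun p hp hle => ?_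
      rw [hprime p hp]
      · infer_instance
      · refine Ideal.span_le.2 fun x hx => ?_
        exact hp.mem_of_pow_mem 2 (hle (hsq x (by simpa using hx)))
    exact hB.of_surjective (Submodule.mkQ_surjective (LinearMap.range j.hom))
  · -- all modules involved are killed by a nonzerodivisor
    obtain ⟨x, xs', rfl⟩ : ∃ x xs', xs = x :: xs' := by
      cases xs with
      | nil => simp at hlen; omega
      | cons x xs' => exact ⟨x, xs', rfl⟩
    have hxreg : IsSMulRegular R x := ((isWeaklyRegular_cons_iff R x xs').1 hreg.1).1
    have hx2 : x ^ 2 ∈ nonZeroDivisors R := by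
      rw [mem_nonZeroDivisors_iff_right]
      intro y hy
      exact (hxreg.pow 2).right_eq_zero_of_smul (by simpa [mul_comm] using hy)
    have hxB : ∀ b : B, x ^ 2 • b = 0 := Module.mem_annihilator.1 (hsq x List.mem_cons_self)
    have hxM : ∀ m : M, x ^ 2 • m = 0 := by
      intro m
      obtain ⟨b, rfl⟩ := Submodule.Quotient.mk_surjective (LinearMap.range j.hom) m
      exact congrArg Submodule.Quotient.mk (hxB b)
    have hxk : ∀ b : ModuleCat.residueModule R, x ^ 2 • b = 0 :=
      Module.mem_annihilator.1 (ModuleCat.mem_annihilator_residueModule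
        (Ideal.pow_mem_of_mem _ (hmem x List.mem_cons_self) 2 two_pos))
    obtain ⟨ρk, hρk0, hρk, hrk⟩ := exists_hasModuleRank_syzygy _ hx2 hxk
    obtain ⟨ρB, hρB0, hρB, -⟩ := exists_hasModuleRank_syzygy B hx2 hxB
    obtain ⟨ρM, hρM0, hρM, hrM⟩ := exists_hasModuleRank_syzygy M hx2 hxM
    have hB : ∀ i, minGenNumber (syzygy B i) = d.choose i := by
      intro i
      have := hβB i
      rw [length_ext_eq_minGenNumber_syzygy] at this
      exact_mod_cast this
    have hM0 : minGenNumber (syzygy M 0) = minGenNumber (syzygy B 0) := by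
      have := ModuleCat.length_ext_zero_of_comp_eq_zero hS (ModuleCat.residueModule R)
        (hjnull 0 hd)
      have := (length_ext_eq_minGenNumber_syzygy M 0).symm.trans
        (this.trans (length_ext_eq_minGenNumber_syzygy B 0))
      exact_mod_cast this
    have hMs : ∀ i, i + 1 < d → minGenNumber (syzygy M (i + 1)) =
        minGenNumber (syzygy (ModuleCat.residueModule R) i) +
          minGenNumber (syzygy B (i + 1)) := by
      intro i hi
      have := ModuleCat.length_ext_succ_of_comp_eq_zero hS (ModuleCat.residueModule R) i
        (hjnull i (by omega)) (hjnull (i + 1) hi)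
      have := (length_ext_eq_minGenNumber_syzygy M (i + 1)).symm.trans
        (this.trans (congrArg₂ (· + ·)
          (length_ext_eq_minGenNumber_syzygy (ModuleCat.residueModule R) i)
          (length_ext_eq_minGenNumber_syzygy B (i + 1))))
      exact_mod_cast this
    -- alternating sums of Betti numbers; the term `ρB` is the rank of a syzygy of `B`
    have key : ∀ i < d, ρM (i + 1) = ρB (i + 1) + ρk i := by
      intro i
      induction i with
      | zero =>
        intro _
        have h1 := hρM 0
        have h2 := hρB 0
        omega
      | succ i ih =>
        intro hi
        have h1 := hρM (i + 1)
        have h2 := hρB (i + 1)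
        have h3 := hρk i
        have h4 := hMs i hi
        have h5 := ih (by omega)
        omega
    -- the last syzygy of `B`, in degree `d`, is free of rank `1`
    have hρBd : ρB d = 1 := by
      have h1 := hρB d
      have h2 := hρB (d + 1)
      rw [hB, Nat.choose_self] at h1
      rw [hB, Nat.choose_succ_self] at h2
      omega
    refine ⟨ρk (d - 1), hrk _, ?_⟩
    have := key (d - 1) (by omega)
    rw [Nat.sub_add_cancel hd, hρBd, add_comm] at this
    exact this ▸ hrM d

end Main

theorem proposition2p1 (R : Type u) [CommRing R] [IsGorensteinLocal R] (d : ℕ) (hd : 0 < d)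
    (hdim : ringKrullDim R = d) :
    (¬ IsRegularLocalRing R →
      ∃ M : ModuleCat.{u} R, projectiveDimension M = ⊤ ∧ IsFiniteLength R M ∧
        ∃ r : ℕ,
          HasModuleRank R (syzygy (ModuleCat.of R (IsLocalRing.ResidueField R)) (d - 1)) r ∧
          HasModuleRank R (syzygy M d) (r + 1)) ∧
    (BuchweitzAffirmative R d →
      ∃ r s : ℕ,
        HasModuleRank R (syzygy (ModuleCat.of R (IsLocalRing.ResidueField R)) (d - 1)) r ∧
        HasModuleRank R (syzygy (ModuleCat.of R (IsLocalRing.ResidueField R)) d) s ∧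
        s ≤ r + 1) := by
  constructor
  · intro hreg
    refine exists_rank_syzygy_eq_add_one hd hdim ?_
    by_contra hk
    exact hreg (isRegularLocalRing_of_projectiveDimension_residueField_ne_top hk)
  · rintro ⟨s, hs, ⟨M₀, hM₀, hfin₀, -⟩, hmin⟩
    have hk : projectiveDimension (ModuleCat.residueModule R) = ⊤ := by
      by_contra hk
      exact projectiveDimension_ne_top_of_isFiniteLength hk hfin₀ hM₀
    obtain ⟨M, hM, hfin, r, hr, hrM⟩ := exists_rank_syzygy_eq_add_one hd hdim hk
    exact ⟨r, s, hr, hs, hmin ⟨M, hM, hfin, hrM⟩⟩
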